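/- **Definitions.** Let $\Lambda$ be a $k$-graph ($k\ge 0$): a nonempty countable small category with a degree functor $d:\Lambda\to\mathbb N^k$ such that whenever $d(\lambda)=m+n$ there are unique $\mu,\nu\in\Lambda$ with $\lambda=\mu\nu$, $d(\mu)=m$, $d(\nu)=n$. Write $\Lambda^n=d^{-1}(n)$, identify objects with $\Lambda^0$, and let $r,s$ be the range (codomain) and source (domain) maps. For $C^*$-algebras $A,B$, an $A$-$B$ $C^*$-correspondence is a right Hilbert $B$-module $X$ with a $*$-homomorphism $\phi:A\to\mathcal L(X)$; $\otimes$ denotes the balanced (interior) tensor product, and $\mathcal K(X)$ the closed linear span of the operators $z\mapsto x\langle y,z\rangle$. $X$ is nondegenerate if $\overline{\operatorname{span}}\,\phi(A)X=X$, and full if the range of its inner product lies in no proper closed two-sided ideal of $B$. A $\Lambda$-system $(A,X,\chi)$ of $C^*$-correspondences consists of a $C^*$-algebra $A_v$ for each $v\in\Lambda^0$, an $A_{r(\lambda)}$-$A_{s(\lambda)}$ correspondence $X_\lambda$ (left action $\phi_\lambda$) for each $\lambda\in\Lambda$, and a map of correspondences $\chi_{\alpha,\beta}:X_\alpha\otimes_{A_{s(\alpha)}}X_\beta\to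 X_{\alpha\beta}$ for each composable pair, which is an isomorphism if $\alpha\notin\Lambda^0$, such that $X_v=A_v$ (the identity correspondence) for $v\in\Lambda^0$; $\chi_{r(\lambda),\lambda}(a\otimes x)=\phi_\lambda(a)x$ and $\chi_{\lambda,s(\lambda)}(x\otimes a)=x\cdot a$; and $\chi_{\alpha\beta,\gamma}(\chi_{\alpha,\beta}\otimes 1)=\chi_{\alpha,\beta\gamma}(1\otimes\chi_{\beta,\gamma})$ for composable $\alpha,\beta,\gamma$. It is regular if $v\Lambda^n=\{\lambda\in\Lambda^n: r(\lambda)=v\}$ is finite and nonempty for all $v\in\Lambda^0$, $n\in\mathbb N^k$, and each $X_\lambda$ is nondegenerate and full with $\phi_\lambda$ injective and $\phi_\lambda(A_{r(\lambda)})\subseteq\mathcal K(X_\lambda)$. A product system over $\mathbb N^k$ of correspondences over a $C^*$-algebra $A$ is a family $(Y_n)_{n\in\mathbb N^k}$ of $A$-$A$ correspondences with an associative multiplication on $\bigsqcup_n Y_n$ mapping $Y_m\times Y_n$ to $Y_{m+n}$, such that $Y_0=A$ is the identity correspondence, multiplication by elements of $Y_0=A$ is the given left and right action of $A$ on each $Y_n$,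 and for $m,n\neq 0$ there is an isomorphism of correspondences $\Theta_{m,n}:Y_m\otimes_AY_n\to Y_{m+n}$ with $\Theta_{m,n}(x\otimes y)=xy$. It is nondegenerate if every $Y_n$ is. **Proposition.** Let $(A,X,\chi)$ be a $\Lambda$-system of $C^*$-correspondences. Let $A=\bigoplus_{v\in\Lambda^0}A_v$ be the $c_0$-direct sum, regard each $X_\lambda$ as an $A$-$A$ correspondence through the coordinates $r(\lambda)$ (left) and $s(\lambda)$ (right), let $Y_n=\bigoplus_{\lambda\in\Lambda^n}X_\lambda$ be the $\ell^2$-direct sum, and let $\iota_\lambda:X_\lambda\to Y_{d(\lambda)}$ be the inclusions. 1. There is exactly one product system structure over $\mathbb N^k$ on $Y=\bigsqcup_{n\in\mathbb N^k}Y_n$ for which $Y_0$ is identified with $A$ by sending $\iota_v(a)$ to the copy of $a\in A_v$ in $A$, and for which $$\iota_\alpha(x)\,\iota_\beta(y)=\begin{cases}\iota_{\alpha\beta}(\chi_{\alpha,\beta}(x\otimes y)) & \text{if } s(\alpha)=r(\beta),\\ 0 & \text{otherwise}\end{cases}\qquad(\alpha,\beta\in\Lambda,\ x\in X_\alpha,\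 y\in X_\beta).$$ 2. If $X$ is regular, then $Y$ is nondegenerate, and for every $n\in\mathbb N^k$ the left action of $A$ on $Y_n$ is an injective homomorphism of $A$ into $\mathcal K(Y_n)$. -/

import Mathlib

open scoped ComplexConjugate TensorProduct CategoryTheory

universe u v w w'

/-- Positivity in a C⋆-algebra: `b = c⋆c` for some `c`. -/
def IsCStarPositive {B : Type*} [NonUnitalCStarAlgebra B] (b : B) : Prop :=
  ∃ c : B, b = star c * c

theorem isCStarPositive_iff {B : Type*} [NonUnitalCStarAlgebra B] (b : B) :
    IsCStarPositive b ↔ letI := CStarAlgebra.spectralOrder B; 0 ≤ b := by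
  let _ := CStarAlgebra.spectralOrder B
  have := CStarAlgebra.spectralOrderedRing B
  exact CStarAlgebra.nonneg_iff_eq_star_mul_self.symm

/-- A right Hilbert module over the C⋆-algebra `B`; `ract x b` is `x · b`, and the inner product is
conjugate linear in the first and linear in the second variable.  Definiteness of the inner product
is contained in `norm_sq`.  (Mathlib's `CStarModule` is about left actions,
`⟪x, a • y⟫ = a * ⟪x, y⟫`.) -/
structure HilbertModule (B : Type u) [NonUnitalCStarAlgebra B] where
  carrier : Type w
  [normedAddCommGroup : NormedAddCommGroup carrier]
  [normedSpace : NormedSpace ℂ carrier]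
  [completeSpace : CompleteSpace carrier]
  inner : carrier →ₗ⋆[ℂ] carrier →ₗ[ℂ] B
  ract : carrier →ₗ[ℂ] B →ₗ[ℂ] carrier
  ract_mul : ∀ x b c, ract x (b * c) = ract (ract x b) c
  inner_ract : ∀ x y b, inner x (ract y b) = inner x y * b
  star_inner : ∀ x y, star (inner x y) = inner y x
  inner_self_pos : ∀ x, IsCStarPositive (inner x x)
  norm_sq : ∀ x, ‖x‖ ^ 2 = ‖inner x x‖

attribute [instance] HilbertModule.normedAddCommGroup HilbertModule.normedSpace
  HilbertModule.completeSpace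

/-- An `A`-`B` C⋆-correspondence: a right Hilbert `B`-module with a ⋆-homomorphism `lact` from `A`
to the adjointable operators; `inner_lact` says that `lact a` is adjointable with adjoint
`lact (star a)`. -/
structure CStarCorr (A : Type u) (B : Type v) [NonUnitalCStarAlgebra A] [NonUnitalCStarAlgebra B]
    extends HilbertModule.{v, w} B where
  lact : A →ₙₐ[ℂ] (carrier →L[ℂ] carrier)
  inner_lact : ∀ a x y, inner (lact a x) y = inner x (lact (star a) y)

instance (A : Type u) (B : Type v) [NonUnitalCStarAlgebra A] [NonUnitalCStarAlgebra B] :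
    CoeSort (CStarCorr.{u, v, w} A B) (Type w) := ⟨fun X => X.carrier⟩

/-- The algebraic data from which a C⋆-correspondence is obtained by dividing out the vectors of
length zero and completing: the inner product need not be definite, and the space need not be
complete. -/
structure PreCStarCorr (A : Type u) (B : Type v) [NonUnitalCStarAlgebra A]
    [NonUnitalCStarAlgebra B] where
  carrier : Type w
  [addCommGroup : AddCommGroup carrier]
  [module : Module ℂ carrier]
  inner : carrier →ₗ⋆[ℂ] carrier →ₗ[ℂ] B
  ract : carrier →ₗ[ℂ] B →ₗ[ℂ] carrier
  ract_mul : ∀ x b c, ract x (b * c) = ract (ract x b) c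
  inner_ract : ∀ x y b, inner x (ract y b) = inner x y * b
  star_inner : ∀ x y, star (inner x y) = inner y x
  inner_self_pos : ∀ x, IsCStarPositive (inner x x)
  lact : A →ₗ[ℂ] carrier →ₗ[ℂ] carrier
  lact_mul : ∀ a b x, lact (a * b) x = lact a (lact b x)
  inner_lact : ∀ a x y, inner (lact a x) y = inner x (lact (star a) y)

namespace PreCStarCorr

attribute [instance] PreCStarCorr.addCommGroup PreCStarCorr.module

variable {A : Type u} {B : Type v} [NonUnitalCStarAlgebra A] [NonUnitalCStarAlgebra B]
  (V : PreCStarCorr.{u, v, w} A B)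

theorem inner_ract_left (x y : V.carrier) (b : B) :
    V.inner (V.ract x b) y = star b * V.inner x y := by
  rw [← V.star_inner, V.inner_ract, star_mul, V.star_inner]

theorem inner_smul_left (c : ℂ) (x y : V.carrier) :
    V.inner (c • x) y = conj c • V.inner x y := by
  rw [map_smulₛₗ, LinearMap.smul_apply]

theorem inner_smul_right (c : ℂ) (x y : V.carrier) :
    V.inner x (c • y) = c • V.inner x y := map_smul _ _ _

theorem norm_inner_sq_le (x y : V.carrier) :
    ‖V.inner x y‖ ^ 2 ≤ ‖V.inner x x‖ * ‖V.inner y y‖ := by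
  let _ := CStarAlgebra.spectralOrder B
  have := CStarAlgebra.spectralOrderedRing B
  set c := V.inner x y with hc
  have key : ∀ q : ℝ, ‖V.inner x x‖ < q → ‖c‖ ^ 2 ≤ q * ‖V.inner y y‖ := by
    intro q hq
    have hq0 : 0 < q := (norm_nonneg _).trans_lt hq
    have h1 : star c * V.inner x x * c ≤ q • (star c * c) :=
      (CStarAlgebra.star_left_conjugate_le_norm_smul
        (hb := ((isCStarPositive_iff _).1 (V.inner_self_pos x)).isSelfAdjoint)).trans
        (smul_le_smul_of_nonneg_right hq.le (star_mul_self_nonneg c))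
    have h2 : 0 ≤ V.inner (V.ract x c - (q : ℂ) • y) (V.ract x c - (q : ℂ) • y) :=
      (isCStarPositive_iff _).1 (V.inner_self_pos _)
    have h3 : V.inner (V.ract x c - (q : ℂ) • y) (V.ract x c - (q : ℂ) • y)
        = star c * V.inner x x * c - (2 * q) • (star c * c) + q ^ 2 • V.inner y y := by
      have h4 : V.inner y x = star c := (V.star_inner x y).symm
      rw [map_sub, map_sub, LinearMap.sub_apply, LinearMap.sub_apply, V.inner_smul_right,
        V.inner_smul_right, V.inner_smul_left, V.inner_smul_left, V.inner_ract, V.inner_ract,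
        V.inner_ract_left,
        V.inner_ract_left, h4, ← hc, Complex.conj_ofReal, smul_smul, ← Complex.ofReal_mul]
      simp only [Complex.coe_smul, mul_assoc, two_mul, add_smul, pow_two]
      abel
    have h5 : star c * c ≤ q • V.inner y y := by
      have h6 : q • (star c * c) ≤ q • (q • V.inner y y) := by
        rw [h3] at h2
        have h7 : (2 * q) • (star c * c) = q • (star c * c) + q • (star c * c) := by
          rw [two_mul, add_smul]
        rw [h7] at h2
        have h8 := add_le_add_left h1 (q • (q • V.inner y y) - q • (star c * c))
        rw [smul_smul, ← pow_two] at h8 ⊢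
        rw [← sub_nonneg]
        refine h2.trans ?_
        rw [← sub_nonneg] at h1 ⊢
        convert h1 using 1
        abel
      exact (smul_le_smul_iff_of_pos_left hq0).1 h6
    have h9 := CStarAlgebra.norm_le_norm_of_nonneg_of_le (star_mul_self_nonneg c) h5
    rwa [CStarRing.norm_star_mul_self, ← pow_two, norm_smul, Real.norm_of_nonneg hq0.le] at h9
  refine ge_of_tendsto (x := nhdsWithin ‖V.inner x x‖ (Set.Ioi ‖V.inner x x‖))
    (f := fun q : ℝ => q * ‖V.inner y y‖) ?_ ?_
  · exact tendsto_nhdsWithin_of_tendsto_nhds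
      ((continuous_id.mul continuous_const).tendsto _)
  · filter_upwards [self_mem_nhdsWithin] with q hq using key q hq

theorem norm_inner_lact_le (a : A) (x : V.carrier) :
    ‖V.inner (V.lact a x) (V.lact a x)‖ ≤ ‖a‖ ^ 2 * ‖V.inner x x‖ := by
  let _ := CStarAlgebra.spectralOrder B
  have := CStarAlgebra.spectralOrderedRing B
  let _ := CStarAlgebra.spectralOrder (Unitization ℂ A)
  have := CStarAlgebra.spectralOrderedRing (Unitization ℂ A)
  have h1 : star (a : Unitization ℂ A) * a ≤ algebraMap ℝ _ (‖(a : Unitization ℂ A)‖ ^ 2) :=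
    CStarAlgebra.star_mul_le_algebraMap_norm_sq
  obtain ⟨d, hd⟩ := CStarAlgebra.nonneg_iff_eq_star_mul_self.1 (sub_nonneg.2 h1)
  rw [Unitization.norm_inr, sub_eq_add_neg] at hd
  have hf := congrArg (fun z => z.fst) hd
  have hs := congrArg (fun z => z.snd) hd
  have hf' : ((‖a‖ ^ 2 : ℝ) : ℂ) = conj d.fst * d.fst := by
    simpa [Algebra.algebraMap_eq_smul_one] using hf
  have hs' : -(star a * a) = conj d.fst • d.snd + (d.fst • star d.snd + star d.snd * d.snd) := by
    simpa [Algebra.algebraMap_eq_smul_one, add_assoc] using hs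
  have h2 : 0 ≤ V.inner (d.fst • x + V.lact d.snd x) (d.fst • x + V.lact d.snd x) :=
    (isCStarPositive_iff _).1 (V.inner_self_pos _)
  have h3 : V.inner (d.fst • x + V.lact d.snd x) (d.fst • x + V.lact d.snd x)
      = (‖a‖ ^ 2 : ℝ) • V.inner x x - V.inner (V.lact a x) (V.lact a x) := by
    have h4 : V.inner (V.lact a x) (V.lact a x) = V.inner x (V.lact (star a * a) x) := by
      rw [V.inner_lact, V.lact_mul]
    have h5 := congrArg (fun t => V.inner x (V.lact t x)) hs'
    simp only [map_neg, LinearMap.neg_apply, map_add, LinearMap.add_apply, map_smul,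
      LinearMap.smul_apply, V.lact_mul] at h5
    rw [sub_eq_add_neg, h4, V.lact_mul, h5, ← Complex.coe_smul, hf']
    rw [map_add, map_add, LinearMap.add_apply, LinearMap.add_apply, V.inner_smul_right,
      V.inner_smul_right,
      V.inner_smul_left, V.inner_smul_left, V.inner_lact, V.inner_lact, smul_smul,
      mul_comm d.fst]
    abel
  rw [h3, sub_nonneg] at h2
  have h9 := CStarAlgebra.norm_le_norm_of_nonneg_of_le
    ((isCStarPositive_iff _).1 (V.inner_self_pos (V.lact a x))) h2
  rwa [norm_smul, Real.norm_of_nonneg (by positivity)] at h9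

/-- `‖x‖ = ‖⟨x, x⟩‖ ^ (1/2)`. -/
noncomputable def seminorm : AddGroupSeminorm V.carrier where
  toFun x := √‖V.inner x x‖
  map_zero' := by simp
  neg' x := by simp
  add_le' x y := by
    rw [Real.sqrt_le_left (by positivity)]
    have h1 : ‖V.inner x y‖ ≤ √‖V.inner x x‖ * √‖V.inner y y‖ := by
      rw [← Real.sqrt_mul (norm_nonneg _)]
      exact Real.le_sqrt_of_sq_le (V.norm_inner_sq_le x y)
    have h2 : ‖V.inner y x‖ = ‖V.inner x y‖ := by rw [← V.star_inner, norm_star]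
    have h3 : V.inner (x + y) (x + y)
        = V.inner x x + V.inner x y + V.inner y x + V.inner y y := by
      simp only [map_add, LinearMap.add_apply]; abel
    rw [h3]
    have h4 := norm_add₄_le (a := V.inner x x) (b := V.inner x y) (c := V.inner y x)
      (d := V.inner y y)
    nlinarith [Real.sq_sqrt (norm_nonneg (V.inner x x)), Real.sq_sqrt (norm_nonneg (V.inner y y))]

noncomputable instance : SeminormedAddCommGroup V.carrier :=
  V.seminorm.toSeminormedAddCommGroup

theorem norm_def (x : V.carrier) : ‖x‖ = √‖V.inner x x‖ := rfl

theorem norm_sq (x : V.carrier) : ‖x‖ ^ 2 = ‖V.inner x x‖ := by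
  rw [norm_def, Real.sq_sqrt (norm_nonneg _)]

noncomputable instance : NormedSpace ℂ V.carrier where
  norm_smul_le c x := by
    rw [norm_def, norm_def, V.inner_smul_left, map_smul, smul_smul, norm_smul]
    simp [Real.sqrt_mul_self]

noncomputable def innerL : V.carrier →L⋆[ℂ] V.carrier →L[ℂ] B :=
  LinearMap.mkContinuous₂ V.inner 1 fun x y => by
    rw [one_mul, norm_def, norm_def, ← Real.sqrt_mul (norm_nonneg _)]
    exact Real.le_sqrt_of_sq_le (V.norm_inner_sq_le x y)

noncomputable def ractL : V.carrier →L[ℂ] B →L[ℂ] V.carrier :=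
  LinearMap.mkContinuous₂ V.ract 1 fun x b => by
    refine le_of_sq_le_sq ?_ (by positivity)
    rw [one_mul, mul_pow, norm_sq, norm_sq, V.inner_ract, V.inner_ract_left]
    calc ‖star b * V.inner x x * b‖ ≤ ‖star b‖ * ‖V.inner x x‖ * ‖b‖ :=
          (norm_mul_le _ _).trans (by gcongr; exact norm_mul_le _ _)
      _ = ‖V.inner x x‖ * ‖b‖ ^ 2 := by rw [norm_star]; ring

noncomputable def lactL : A →L[ℂ] V.carrier →L[ℂ] V.carrier :=
  LinearMap.mkContinuous₂ V.lact 1 fun a x => by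
    refine le_of_sq_le_sq ?_ (by positivity)
    rw [one_mul, mul_pow, norm_sq, norm_sq]
    exact V.norm_inner_lact_le a x

/-- The Hausdorff completion for the seminorm `‖⟨x, x⟩‖ ^ (1/2)`. -/
abbrev Compl : Type w := UniformSpace.Completion V.carrier

noncomputable def toCompl : V.carrier →L[ℂ] V.Compl := UniformSpace.Completion.toComplL

noncomputable def complInner : V.Compl →L⋆[ℂ] V.Compl →L[ℂ] B :=
  ((V.innerL.extend V.toCompl).flip.extend V.toCompl).flip

noncomputable def complRact : V.Compl →L[ℂ] B →L[ℂ] V.Compl :=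
  ((ContinuousLinearMap.compL ℂ B V.carrier V.Compl V.toCompl).comp V.ractL).extend V.toCompl

noncomputable def complLact : A →L[ℂ] V.Compl →L[ℂ] V.Compl :=
  (((ContinuousLinearMap.compL ℂ V.carrier V.carrier V.Compl V.toCompl).comp
    V.lactL).flip.extend V.toCompl).flip

theorem denseRange_toCompl : DenseRange V.toCompl := UniformSpace.Completion.denseRange_coe

theorem isUniformInducing_toCompl : IsUniformInducing V.toCompl :=
  UniformSpace.Completion.isUniformInducing_coe _

theorem complInner_coe (x y : V.carrier) :
    V.complInner (V.toCompl x) (V.toCompl y) = V.inner x y := by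
  rw [complInner, ContinuousLinearMap.flip_apply,
    ContinuousLinearMap.extend_eq _ V.denseRange_toCompl V.isUniformInducing_toCompl,
    ContinuousLinearMap.flip_apply,
    ContinuousLinearMap.extend_eq _ V.denseRange_toCompl V.isUniformInducing_toCompl]
  rfl

theorem complRact_coe (x : V.carrier) (b : B) :
    V.complRact (V.toCompl x) b = V.toCompl (V.ract x b) := by
  rw [complRact,
    ContinuousLinearMap.extend_eq _ V.denseRange_toCompl V.isUniformInducing_toCompl]
  rfl

theorem complLact_coe (a : A) (x : V.carrier) :
    V.complLact a (V.toCompl x) = V.toCompl (V.lact a x) := by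
  rw [complLact, ContinuousLinearMap.flip_apply,
    ContinuousLinearMap.extend_eq _ V.denseRange_toCompl V.isUniformInducing_toCompl]
  rfl

theorem complInner_star (x y : V.Compl) : star (V.complInner x y) = V.complInner y x := by
  refine V.denseRange_toCompl.induction_on₂ (isClosed_eq (by fun_prop) (by fun_prop)) ?_ x y
  intro x y
  rw [complInner_coe, complInner_coe, V.star_inner]

/-- The C⋆-correspondence obtained by Hausdorff completion. -/
noncomputable def completion : CStarCorr.{u, v, w} A B where
  carrier := V.Compl
  inner := V.complInner.toLinearMap₁₂
  ract := V.complRact.toLinearMap₁₂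
  ract_mul x b c := by
    change V.complRact x (b * c) = V.complRact (V.complRact x b) c
    refine V.denseRange_toCompl.induction_on x (isClosed_eq (by fun_prop) (by fun_prop)) ?_
    intro x
    rw [complRact_coe, complRact_coe, complRact_coe, V.ract_mul]
  inner_ract x y b := by
    change V.complInner x (V.complRact y b) = V.complInner x y * b
    refine V.denseRange_toCompl.induction_on₂ (isClosed_eq (by fun_prop) (by fun_prop)) ?_ x y
    intro x y
    rw [complRact_coe, complInner_coe, complInner_coe, V.inner_ract]
  star_inner x y := V.complInner_star x y
  inner_self_pos x := by
    let _ := CStarAlgebra.spectralOrder B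
    have := CStarAlgebra.spectralOrderedRing B
    change IsCStarPositive (V.complInner x x)
    rw [isCStarPositive_iff]
    refine V.denseRange_toCompl.induction_on x
      (isClosed_le continuous_const (by fun_prop)) ?_
    intro x
    rw [complInner_coe]
    exact (isCStarPositive_iff _).1 (V.inner_self_pos x)
  norm_sq x := by
    change ‖x‖ ^ 2 = ‖V.complInner x x‖
    refine V.denseRange_toCompl.induction_on x (isClosed_eq (by fun_prop) (by fun_prop)) ?_
    intro x
    rw [complInner_coe, ← V.norm_sq]
    exact congrArg (· ^ 2) (UniformSpace.Completion.norm_coe x)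
  lact :=
    { toFun := V.complLact
      map_smul' := map_smul _
      map_zero' := map_zero _
      map_add' := map_add _
      map_mul' := fun a b => by
        ext x
        change V.complLact (a * b) x = V.complLact a (V.complLact b x)
        refine V.denseRange_toCompl.induction_on x (isClosed_eq (by fun_prop) (by fun_prop)) ?_
        intro x
        rw [complLact_coe, complLact_coe, complLact_coe, V.lact_mul] }
  inner_lact a x y := by
    change V.complInner (V.complLact a x) y = V.complInner x (V.complLact (star a) y)
    refine V.denseRange_toCompl.induction_on₂ (isClosed_eq (by fun_prop) (by fun_prop)) ?_ x y
    intro x y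
    rw [complLact_coe, complLact_coe, complInner_coe, complInner_coe, V.inner_lact]

end PreCStarCorr

section Gram

variable {A : Type u} [NonUnitalCStarAlgebra A]

theorem exists_eq_star_mul_self_of_conj (G : A) (hG : IsSelfAdjoint G)
    (h : ∀ N L : A, star N = N → N * G * N = -(star L * L) → L = 0) :
    ∃ H : A, G = star H * H := by
  let _ := CStarAlgebra.spectralOrder A
  have := CStarAlgebra.spectralOrderedRing A
  obtain ⟨K, hK⟩ := CStarAlgebra.nonneg_iff_eq_star_mul_self.1 (CFC.negPart_nonneg G)
  have hNs : star (G⁻) = G⁻ := (CFC.negPart_nonneg G).isSelfAdjoint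
  have h4 : K * G⁻ = 0 := by
    refine h (G⁻) (K * G⁻) hNs ?_
    have h2 : G⁻ * G = -(G⁻ * G⁻) := by
      conv_lhs => enter [2]; rw [← CFC.posPart_sub_negPart G hG]
      rw [mul_sub, CFC.negPart_mul_posPart, zero_sub]
    rw [h2, star_mul, hNs]
    have h3 : G⁻ * star K * (K * G⁻) = G⁻ * (star K * K) * G⁻ := by simp only [mul_assoc]
    rw [h3, ← hK, neg_mul]
  have h12 : G⁻ = 0 := by
    have h13 : star (G⁻) * G⁻ = 0 := by
      rw [hNs]
      nth_rewrite 1 [hK]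
      rw [mul_assoc, h4, mul_zero]
    exact CStarRing.star_mul_self_eq_zero_iff _ |>.1 h13
  refine CStarAlgebra.nonneg_iff_eq_star_mul_self.1 ?_
  rw [← CFC.posPart_sub_negPart G hG, h12, sub_zero]
  exact CFC.posPart_nonneg G

/-- Gram matrices over a C⋆-algebra are positive. -/
theorem HilbertModule.gram_eq_star_mul_self (X : HilbertModule.{u, w} A) {n : Type*} [Fintype n]
    (x : n → X.carrier) :
    ∃ H : n → n → A, ∀ i j, X.inner (x i) (x j) = ∑ k, star (H k i) * H k j := by
  let _ := CStarAlgebra.spectralOrder A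
  have := CStarAlgebra.spectralOrderedRing A
  let G : CStarMatrix n n A := CStarMatrix.ofMatrix (Matrix.of fun i j => X.inner (x i) (x j))
  have hG : IsSelfAdjoint G := by
    ext i j
    exact X.star_inner (x j) (x i)
  obtain ⟨H, hH⟩ := exists_eq_star_mul_self_of_conj G hG fun N L hN hL => by
    ext k j
    have h5 : 0 ≤ (N * G * N) j j := by
      have h6 : (N * G * N) j j
          = X.inner (∑ i, X.ract (x i) (N i j)) (∑ i, X.ract (x i) (N i j)) := by
        have h7 : ∀ i, N j i = star (N i j) := fun i => by
          conv_lhs => rw [← hN]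
          rfl
        have h8 : ∀ y z b, X.inner (X.ract y b) z = star b * X.inner y z := fun y z b => by
          rw [← X.star_inner, X.inner_ract, star_mul, X.star_inner]
        simp only [CStarMatrix.mul_apply, map_sum, LinearMap.sum_apply, X.inner_ract, h8, h7,
          Finset.sum_mul]
        rfl
      rw [h6]
      exact (isCStarPositive_iff _).1 (X.inner_self_pos _)
    rw [hL] at h5
    have h9 : (star L * L) j j = ∑ l, star (L l j) * L l j := by
      rw [CStarMatrix.mul_apply]
      rfl
    have h10 : ∑ l, star (L l j) * L l j = 0 := by
      refine le_antisymm ?_ (Finset.sum_nonneg fun l _ => star_mul_self_nonneg _)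
      rw [← h9, ← neg_nonneg]
      exact h5
    have h11 := (Finset.sum_eq_zero_iff_of_nonneg
      (fun l _ => star_mul_self_nonneg (L l j))).1 h10 k (Finset.mem_univ k)
    exact CStarRing.star_mul_self_eq_zero_iff _ |>.1 h11
  refine ⟨fun i j => H i j, fun i j => ?_⟩
  have h15 : G i j = (star H * H) i j := by rw [← hH]
  rw [CStarMatrix.mul_apply] at h15
  exact h15

end Gram

namespace CStarCorr

section Tensor

universe x

variable {A : Type u} {B : Type v} {C : Type x} [NonUnitalCStarAlgebra A]
  [NonUnitalCStarAlgebra B] [NonUnitalCStarAlgebra C]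

theorem isCStarPositive_sum {ι : Type*} (s : Finset ι) (f : ι → B)
    (h : ∀ i ∈ s, IsCStarPositive (f i)) : IsCStarPositive (∑ i ∈ s, f i) := by
  let _ := CStarAlgebra.spectralOrder B
  have := CStarAlgebra.spectralOrderedRing B
  rw [isCStarPositive_iff]
  exact Finset.sum_nonneg fun i hi => (isCStarPositive_iff _).1 (h i hi)

theorem inner_ract_left (X : CStarCorr.{u, v, w} A B) (y z : X) (b : B) :
    X.inner (X.ract y b) z = star b * X.inner y z := by
  rw [← X.star_inner, X.inner_ract, star_mul, X.star_inner]

theorem lact_ract (X : CStarCorr.{u, v, w} A B) (a : A) (x : X) (b : B) :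
    X.lact a (X.ract x b) = X.ract (X.lact a x) b := by
  have h : ∀ z, X.inner z (X.lact a (X.ract x b)) = X.inner z (X.ract (X.lact a x) b) := by
    intro z
    have h1 : ∀ y, X.inner z (X.lact a y) = X.inner (X.lact (star a) z) y := fun y => by
      rw [X.inner_lact, star_star]
    rw [h1, X.inner_ract, X.inner_ract, h1]
  rw [← sub_eq_zero, ← norm_eq_zero, ← pow_eq_zero_iff two_ne_zero, X.norm_sq,
    map_sub, h, sub_self, norm_zero]

/-- `⟨x ⊗ y, x' ⊗ y'⟩ = ⟨y, ⟨x, x'⟩ · y'⟩` on the algebraic tensor product. -/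
noncomputable def tensorInner (X : CStarCorr.{u, v, w} A B) (Y : CStarCorr.{v, x, w'} B C) :
    X ⊗[ℂ] Y →ₗ⋆[ℂ] X ⊗[ℂ] Y →ₗ[ℂ] C :=
  TensorProduct.lift <| LinearMap.mk₂'ₛₗ (starRingEnd ℂ) (starRingEnd ℂ)
    (fun x y => TensorProduct.lift <| LinearMap.mk₂ ℂ
      (fun x' y' => Y.inner y (Y.lact (X.inner x x') y'))
      (by intros; simp) (by intros; simp) (by intros; simp) (by intros; simp))
    (by intros; ext; simp) (by intros; ext; simp)
    (by intros; ext; simp) (by intros; ext; simp)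

noncomputable def preTensor (X : CStarCorr.{u, v, w} A B) (Y : CStarCorr.{v, x, w'} B C) :
    PreCStarCorr.{u, x, max w w'} A C where
  carrier := X ⊗[ℂ] Y
  inner := tensorInner X Y
  ract := (LinearMap.lTensorHom X.carrier ∘ₗ Y.ract.flip).flip
  ract_mul t b c := by
    induction t with
    | zero => simp
    | add s t hs ht => simp only [map_add, LinearMap.add_apply, hs, ht]
    | tmul x y => simp [Y.ract_mul]
  inner_ract s t b := by
    induction s with
    | zero => simp
    | add s s' hs hs' => simp only [map_add, LinearMap.add_apply, hs, hs', add_mul]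
    | tmul x y =>
      induction t with
      | zero => simp
      | add s t hs ht => simp only [map_add, LinearMap.add_apply, hs, ht, add_mul]
      | tmul x' y' => simp [tensorInner, Y.inner_ract, Y.lact_ract]
  star_inner s t := by
    induction s with
    | zero => simp
    | add s s' hs hs' => simp only [map_add, LinearMap.add_apply, star_add, hs, hs']
    | tmul x y =>
      induction t with
      | zero => simp
      | add s t hs ht => simp only [map_add, LinearMap.add_apply, star_add, hs, ht]
      | tmul x' y' => 
        simp [tensorInner, Y.star_inner, Y.inner_lact, X.star_inner]
  inner_self_pos t := by
    obtain ⟨S, rfl⟩ := TensorProduct.exists_finset t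
    obtain ⟨H, hH⟩ := X.gram_eq_star_mul_self fun i : S => i.1.1
    have h : tensorInner X Y (∑ i ∈ S, i.1 ⊗ₜ[ℂ] i.2) (∑ i ∈ S, i.1 ⊗ₜ[ℂ] i.2)
        = ∑ k, Y.inner (∑ i : S, Y.lact (H k i) i.1.2) (∑ i : S, Y.lact (H k i) i.1.2) := by
      have hij : ∀ i j : S, tensorInner X Y (i.1.1 ⊗ₜ[ℂ] i.1.2) (j.1.1 ⊗ₜ[ℂ] j.1.2)
          = ∑ k, Y.inner (Y.lact (H k i) i.1.2) (Y.lact (H k j) j.1.2) := fun i j => by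
        change Y.inner _ (Y.lact (X.inner _ _) _) = _
        rw [hH i j, map_sum, sum_apply, map_sum]
        simp only [Y.inner_lact, map_mul, mul_apply_eq_comp]
      rw [← Finset.sum_coe_sort S]
      simp only [map_sum, LinearMap.sum_apply, hij]
      rw [Finset.sum_congr rfl fun _ _ => Finset.sum_comm, Finset.sum_comm]
    rw [h]
    exact isCStarPositive_sum _ _ fun k _ => Y.inner_self_pos _
  lact := LinearMap.mk₂ ℂ (fun a => LinearMap.rTensor Y.carrier (X.lact a : X →ₗ[ℂ] X))
    (by intros; simp [LinearMap.rTensor_add]) (by intros; simp [LinearMap.rTensor_smul])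
    (by intros; simp) (by intros; simp)
  lact_mul a b t := by
    induction t with
    | zero => simp
    | add s t hs ht => simp only [map_add, hs, ht]
    | tmul x y => simp
  inner_lact a s t := by
    induction s with
    | zero => simp
    | add s s' hs hs' => simp only [map_add, LinearMap.add_apply, hs, hs']
    | tmul x y =>
      induction t with
      | zero => simp
      | add s t hs ht => simp only [map_add, hs, ht]
      | tmul x' y' => simp [tensorInner, X.inner_lact]

/-- The balanced (interior) tensor product `X ⊗_B Y`: the Hausdorff completion of the algebraic
tensor product for `⟨x ⊗ y, x' ⊗ y'⟩ = ⟨y, ⟨x, x'⟩ · y'⟩`, with `(x ⊗ y) · c = x ⊗ (y · c)` and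
`a · (x ⊗ y) = (a · x) ⊗ y`. -/
noncomputable def tensor (X : CStarCorr.{u, v, w} A B) (Y : CStarCorr.{v, x, w'} B C) :
    CStarCorr.{u, x, max w w'} A C :=
  (preTensor X Y).completion

/-- The elementary tensor `x ⊗ y` in `X ⊗_B Y`. -/
noncomputable def tmul (X : CStarCorr.{u, v, w} A B) (Y : CStarCorr.{v, x, w'} B C) (x : X) (y : Y) :
    X.tensor Y :=
  (preTensor X Y).toCompl (x ⊗ₜ[ℂ] y)

end Tensor

section DirectSum

variable {A : Type u} {B : Type v} [NonUnitalCStarAlgebra A] [NonUnitalCStarAlgebra B]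

theorem finite_support_inner {ι : Type w'} (X : ι → CStarCorr.{u, v, w} A B)
    (x y : Π₀ i, (X i).carrier) :
    (Function.support fun i => (X i).inner (x i) (y i)).Finite := by
  refine x.finite_support.subset fun i hi => ?_
  contrapose! hi
  simp only [Set.mem_ofPred_eq, not_not] at hi
  simp [hi]

noncomputable def preDirectSum {ι : Type w'} (X : ι → CStarCorr.{u, v, w} A B) :
    PreCStarCorr.{u, v, max w' w} A B where
  carrier := Π₀ i, (X i).carrier
  inner := LinearMap.mk₂'ₛₗ (starRingEnd ℂ) (RingHom.id ℂ)
    (fun x y => ∑ᶠ i, (X i).inner (x i) (y i))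
    (fun x x' y => by
      rw [← finsum_add_distrib (finite_support_inner X x y) (finite_support_inner X x' y)]
      simp)
    (fun c x y => by
      rw [smul_finsum' _ (finite_support_inner X x y)]
      simp)
    (fun x y y' => by
      rw [← finsum_add_distrib (finite_support_inner X x y) (finite_support_inner X x y')]
      simp)
    (fun c x y => by
      rw [smul_finsum' _ (finite_support_inner X x y)]
      simp)
  ract := LinearMap.mk₂ ℂ (fun x b => x.mapRange (fun i z => (X i).ract z b) (by simp))
    (by intros; ext; simp) (by intros; ext; simp) (by intros; ext; simp) (by intros; ext; simp)
  ract_mul x b c := by ext i; simp [(X i).ract_mul]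
  inner_ract x y b := by
    simp only [LinearMap.mk₂'ₛₗ_apply, LinearMap.mk₂_apply, DFinsupp.mapRange_apply,
      HilbertModule.inner_ract]
    rw [finsum_mul' _ _ (finite_support_inner X x y)]
  star_inner x y := by
    simp only [LinearMap.mk₂'ₛₗ_apply]
    have h := (starAddEquiv : B ≃+ B).toAddMonoidHom.map_finsum (finite_support_inner X x y)
    refine h.trans (finsum_congr fun i => (X i).star_inner _ _)
  inner_self_pos x := by
    simp only [LinearMap.mk₂'ₛₗ_apply]
    rw [finsum_eq_sum _ (finite_support_inner X x x)]
    exact isCStarPositive_sum _ _ fun i _ => (X i).inner_self_pos _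
  lact := LinearMap.mk₂ ℂ (fun a x => x.mapRange (fun i z => (X i).lact a z) (by simp))
    (by intros; ext; simp) (by intros; ext; simp) (by intros; ext; simp) (by intros; ext; simp)
  lact_mul a b x := by ext i; simp
  inner_lact a x y := by
    simp [(X _).inner_lact]

/-- The `ℓ²`-direct sum of C⋆-correspondences: the completion of the algebraic direct sum for
`⟨x, y⟩ = ∑ i, ⟨x i, y i⟩`, with the coordinatewise actions. -/
noncomputable def directSum {ι : Type w'} (X : ι → CStarCorr.{u, v, w} A B) :
    CStarCorr.{u, v, max w' w} A B :=
  (preDirectSum X).completion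

open scoped Classical in
/-- The inclusion of the `i`-th summand. -/
noncomputable def directSumIncl {ι : Type w'} (X : ι → CStarCorr.{u, v, w} A B) (i : ι) (x : X i) :
    directSum X :=
  (preDirectSum X).toCompl (DFinsupp.single i x : Π₀ i, (X i).carrier)

end DirectSum

section Basic

variable {A : Type u} {B : Type v} [NonUnitalCStarAlgebra A] [NonUnitalCStarAlgebra B]

/-- The identity correspondence: `A` over itself, with `⟨x, y⟩ = star x * y` and multiplication on
both sides. -/
noncomputable def ident (A : Type u) [NonUnitalCStarAlgebra A] : CStarCorr.{u, u, u} A A where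
  carrier := A
  inner := LinearMap.mk₂'ₛₗ (starRingEnd ℂ) (RingHom.id ℂ) (fun x y => star x * y)
    (by intros; simp [add_mul]) (by intros; simp [smul_mul_assoc])
    (by intros; simp [mul_add]) (by intros; simp [mul_smul_comm])
  ract := LinearMap.mul ℂ A
  ract_mul x b c := by simp [mul_assoc]
  inner_ract x y b := by simp [mul_assoc]
  star_inner x y := by simp
  inner_self_pos x := ⟨x, rfl⟩
  norm_sq x := by simp [CStarRing.norm_star_mul_self, pow_two]
  lact := NonUnitalAlgHom.Lmul ℂ A
  inner_lact a x y := by simp [mul_assoc]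

/-- Maps of C⋆-correspondences: linear, compatible with both actions, preserving inner products. -/
structure Hom (X : CStarCorr.{u, v, w} A B) (Y : CStarCorr.{u, v, w'} A B)
    extends X.carrier →ₗ[ℂ] Y.carrier where
  map_inner : ∀ x y, Y.inner (toFun x) (toFun y) = X.inner x y
  map_ract : ∀ x b, toFun (X.ract x b) = Y.ract (toFun x) b
  map_lact : ∀ a x, toFun (X.lact a x) = Y.lact a (toFun x)

instance (X : CStarCorr.{u, v, w} A B) (Y : CStarCorr.{u, v, w'} A B) :
    CoeFun (Hom X Y) (fun _ => X → Y) := ⟨fun f => f.toLinearMap⟩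

def Hom.IsIso {X : CStarCorr.{u, v, w} A B} {Y : CStarCorr.{u, v, w'} A B} (f : Hom X Y) : Prop :=
  Function.Bijective f

def IsNondegenerate (X : CStarCorr.{u, v, w} A B) : Prop :=
  (Submodule.span ℂ {z : X | ∃ (a : A) (x : X), X.lact a x = z}).topologicalClosure = ⊤

/-- The range of the inner product lies in no proper closed two-sided ideal. -/
def IsFull (X : CStarCorr.{u, v, w} A B) : Prop :=
  ∀ I : TwoSidedIdeal B, IsClosed (I : Set B) → (∀ x y : X, X.inner x y ∈ I) → I = ⊤

/-- The underlying algebraic data. -/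
def toPreCStarCorr (X : CStarCorr.{u, v, w} A B) : PreCStarCorr.{u, v, w} A B where
  carrier := X.carrier
  inner := X.inner
  ract := X.ract
  ract_mul := X.ract_mul
  inner_ract := X.inner_ract
  star_inner := X.star_inner
  inner_self_pos := X.inner_self_pos
  lact := LinearMap.mk₂ ℂ (fun a x => X.lact a x) (by intros; simp) (by intros; simp)
    (by intros; simp) (by intros; simp)
  lact_mul a b x := by simp
  inner_lact := X.inner_lact

/-- The rank-one operator `z ↦ x · ⟨y, z⟩`. -/
noncomputable def rankOne (X : CStarCorr.{u, v, w} A B) (x y : X) : X →L[ℂ] X :=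
  LinearMap.mkContinuous (X.ract x ∘ₗ X.inner y) (‖x‖ * ‖y‖) fun z => by
    have hn : ∀ z : X, ‖z‖ = ‖(show X.toPreCStarCorr.carrier from z)‖ := fun z => by
      rw [← sq_eq_sq₀ (norm_nonneg _) (norm_nonneg _), X.norm_sq, PreCStarCorr.norm_sq]
      rfl
    have h1 : ‖X.ract x (X.inner y z)‖ ≤ ‖x‖ * ‖X.inner y z‖ := by
      have h := X.toPreCStarCorr.ractL.le_of_opNorm₂_le_of_le
        (LinearMap.mkContinuous₂_norm_le _ zero_le_one _)
        (le_refl ‖(show X.toPreCStarCorr.carrier from x)‖) (le_refl ‖X.inner y z‖)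
      rw [hn, hn x]
      rw [one_mul] at h
      exact h
    have h2 : ‖X.inner y z‖ ≤ ‖y‖ * ‖z‖ := by
      have h := X.toPreCStarCorr.innerL.le_of_opNorm₂_le_of_le
        (LinearMap.mkContinuous₂_norm_le _ zero_le_one _)
        (le_refl ‖(show X.toPreCStarCorr.carrier from y)‖) (le_refl ‖(show X.toPreCStarCorr.carrier from z)‖)
      rw [hn, hn z]
      rw [one_mul] at h
      exact h
    calc ‖X.ract x (X.inner y z)‖ ≤ ‖x‖ * ‖X.inner y z‖ := h1
      _ ≤ ‖x‖ * (‖y‖ * ‖z‖) := by gcongr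
      _ = ‖x‖ * ‖y‖ * ‖z‖ := by ring

/-- The compact operators: the closed linear span of the rank-one operators. -/
noncomputable def compactOperators (X : CStarCorr.{u, v, w} A B) : Submodule ℂ (X →L[ℂ] X) :=
  (Submodule.span ℂ {T | ∃ x y : X, T = X.rankOne x y}).topologicalClosure

end Basic
end CStarCorr

section C0Sum

open scoped ENNReal Topology

variable {V : Type w} (A : V → Type u) [∀ v, NonUnitalCStarAlgebra (A v)]

/-- The families `a ∈ ∏ A v` with `‖a v‖ → 0`, inside the `ℓ^∞`-direct sum. -/
def c0Subalgebra : NonUnitalStarSubalgebra ℂ (lp A ∞) where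
  carrier := {a | Filter.Tendsto (fun v => ‖a v‖) Filter.cofinite (𝓝 0)}
  add_mem' {a b} ha hb := by
    refine squeeze_zero (fun v => norm_nonneg _) (fun v => norm_add_le (a v) (b v)) ?_
    simpa using Filter.Tendsto.add ha hb
  zero_mem' := by simp [tendsto_const_nhds]
  mul_mem' {a b} ha hb := by
    refine squeeze_zero (fun v => norm_nonneg _) (fun v => norm_mul_le (a v) (b v)) ?_
    simpa using Filter.Tendsto.mul ha hb
  smul_mem' c a ha := by
    have h : Filter.Tendsto (fun v => ‖c‖ * ‖a v‖) Filter.cofinite (𝓝 (‖c‖ * 0)) :=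
      Filter.Tendsto.const_mul _ ha
    simpa [norm_smul] using h
  star_mem' {a} ha := by
    simpa using ha

instance c0Subalgebra_isClosed : IsClosed (c0Subalgebra A : Set (lp A ∞)) := by
  rw [← closure_subset_iff_isClosed]
  intro a ha
  change Filter.Tendsto (fun v => ‖a v‖) Filter.cofinite (𝓝 0)
  rw [Metric.tendsto_nhds]
  intro ε hε
  obtain ⟨b, hb, hab⟩ := Metric.mem_closure_iff.1 ha (ε / 2) (half_pos hε)
  have hb' : Filter.Tendsto (fun v => ‖b v‖) Filter.cofinite (𝓝 0) := hb
  filter_upwards [(Metric.tendsto_nhds.1 hb') (ε / 2) (half_pos hε)] with v hv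
  rw [Real.dist_0_eq_abs, abs_norm] at hv ⊢
  have h1 : ‖a v - b v‖ ≤ ‖a - b‖ := lp.norm_apply_le_norm ENNReal.top_ne_zero (a - b) v
  rw [dist_eq_norm] at hab
  have h2 : ‖a v‖ ≤ ‖a v - b v‖ + ‖b v‖ := by
    simpa using norm_add_le (a v - b v) (b v)
  linarith

/-- The `c₀`-direct sum of the C⋆-algebras `A v`. -/
abbrev C0Sum : Type (max w u) := c0Subalgebra A

open scoped Classical in
/-- The inclusion of the summand `A v`. -/
noncomputable def C0Sum.single (v : V) : A v →ₗ[ℂ] C0Sum A where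
  toFun a := ⟨lp.single ∞ v a, by
    refine tendsto_const_nhds.congr' ?_
    filter_upwards [(Set.finite_singleton v).compl_mem_cofinite] with j hj
    rw [lp.single_apply_ne _ _ _ hj, norm_zero]⟩
  map_add' a b := Subtype.ext (lp.single_add ∞ v a b)
  map_smul' c a := Subtype.ext (lp.single_smul ∞ v c a)

variable {A}

theorem C0Sum.single_mul (v : V) (a : A v) (b : C0Sum A) :
    C0Sum.single A v (a * b.1 v) = C0Sum.single A v a * b := by
  classical
  ext j
  change Pi.single v (a * b.1 v) j = Pi.single v a j * b.1 j
  rcases eq_or_ne j v with rfl | h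
  · simp
  · simp [Pi.single_eq_of_ne h]

theorem C0Sum.star_single (v : V) (a : A v) :
    star (C0Sum.single A v a) = C0Sum.single A v (star a) := by
  classical
  ext j
  change star (Pi.single v a j) = Pi.single v (star a) j
  rcases eq_or_ne j v with rfl | h
  · simp
  · simp [Pi.single_eq_of_ne h]

theorem C0Sum.norm_single (v : V) (a : A v) : ‖C0Sum.single A v a‖ = ‖a‖ := by
  classical
  exact lp.norm_single (p := ∞) (by simp) v a

/-- An `A r`-`A s` correspondence regarded as a correspondence over the `c₀`-direct sum `A`:
`b` acts on the left by `b r` and on the right by `b s`, and the inner product takes values in the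
summand `A s`. -/
noncomputable def CStarCorr.inflate {r s : V} (X : CStarCorr.{u, u, w'} (A r) (A s)) :
    CStarCorr.{max w u, max w u, w'} (C0Sum A) (C0Sum A) where
  carrier := X.carrier
  inner := X.inner.compr₂ₛₗ (C0Sum.single A s)
  ract := LinearMap.mk₂ ℂ (fun x b => X.ract x (b.1 s)) (by intros; simp) (by intros; simp)
    (by intros; simp) (by intros; simp)
  ract_mul x b c := by simp [X.ract_mul]
  inner_ract x y b := by simp [X.inner_ract, C0Sum.single_mul]
  star_inner x y := by simp [C0Sum.star_single, X.star_inner]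
  inner_self_pos x := by
    obtain ⟨c, hc⟩ := X.inner_self_pos x
    refine ⟨C0Sum.single A s c, ?_⟩
    rw [C0Sum.star_single, ← C0Sum.single_mul]
    change C0Sum.single A s (X.inner x x) = _
    rw [hc]
    congr 2
    classical
    exact (lp.single_apply_self ∞ s c).symm
  norm_sq x := (X.norm_sq x).trans (C0Sum.norm_single s _).symm
  lact :=
    { toFun := fun a => X.lact (a.1 r)
      map_smul' := by intros; simp
      map_zero' := by simp
      map_add' := by intros; simp
      map_mul' := by intros; simp }
  inner_lact a x y := by simp [X.inner_lact]

end C0Sum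

/-- A `k`-graph structure on the small category `Λ`.  A morphism `f : a ⟶ b` has source `a` and
range `b`, and the composite written `μν` is `ν ≫ μ`.  Objects are identified with the vertices,
that is, with the morphisms of degree zero (which are the identities by the factorisation
property). -/
structure KGraph (k : ℕ) (Λ : Type u) [CategoryTheory.Category.{v} Λ] where
  degree : ∀ {a b : Λ}, (a ⟶ b) → (Fin k → ℕ)
  degree_id : ∀ a : Λ, degree (𝟙 a) = 0
  degree_comp : ∀ {a b c : Λ} (μ : b ⟶ c) (ν : a ⟶ b), degree (ν ≫ μ) = degree μ + degree ν
  factorisation : ∀ {a b : Λ} (f : a ⟶ b) (m n : Fin k → ℕ), degree f = m + n →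
    ∃! p : Σ c : Λ, (c ⟶ b) × (a ⟶ c),
      degree p.2.1 = m ∧ degree p.2.2 = n ∧ p.2.2 ≫ p.2.1 = f
  nonempty : Nonempty Λ
  countable : Countable (Σ a b : Λ, (a ⟶ b))

/-- The set `Λⁿ` of paths of degree `n`. -/
structure KGraph.Path {k : ℕ} {Λ : Type u} [CategoryTheory.Category.{v} Λ] (D : KGraph k Λ)
    (n : Fin k → ℕ) where
  src : Λ
  rng : Λ
  hom : src ⟶ rng
  degree_eq : D.degree hom = n

/-- For every vertex `v` and every `n`, the set of paths of degree `n` with range `v` is finite and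
nonempty. -/
def KGraph.IsRowFiniteNoSources {k : ℕ} {Λ : Type u} [CategoryTheory.Category.{v} Λ]
    (D : KGraph k Λ) : Prop :=
  ∀ (v : Λ) (n : Fin k → ℕ),
    {p : D.Path n | p.rng = v}.Finite ∧ {p : D.Path n | p.rng = v}.Nonempty

universe a

/-- A `Λ`-system of C⋆-correspondences.  The identification of `X (𝟙 v)` with the identity
correspondence over `A v` is the isomorphism `unit v`.  Equations between elements of `X f` and
`X g` with `f = g` are stated in the disjoint union of the `X f`. -/
structure LambdaSystem {k : ℕ} {Λ : Type u} [CategoryTheory.Category.{v} Λ]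
    (D : KGraph k Λ) where
  A : Λ → Type a
  [cstar : ∀ v, NonUnitalCStarAlgebra (A v)]
  X : ∀ {u v : Λ} (_ : u ⟶ v), CStarCorr.{a, a, w} (A v) (A u)
  chi : ∀ {u v w : Λ} (α : v ⟶ w) (β : u ⟶ v), CStarCorr.Hom ((X α).tensor (X β)) (X (β ≫ α))
  chi_isIso : ∀ {u v w : Λ} (α : v ⟶ w) (β : u ⟶ v), D.degree α ≠ 0 → (chi α β).IsIso
  unit : ∀ v : Λ, CStarCorr.Hom (X (𝟙 v)) (CStarCorr.ident (A v))
  unit_isIso : ∀ v : Λ, (unit v).IsIso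
  chi_range : ∀ {u v : Λ} (f : u ⟶ v) (e : X (𝟙 v)) (x : X f),
    (⟨f ≫ 𝟙 v, chi (𝟙 v) f ((X (𝟙 v)).tmul (X f) e x)⟩ : Σ g : u ⟶ v, X g)
      = ⟨f, (X f).lact (unit v e) x⟩
  chi_source : ∀ {u v : Λ} (f : u ⟶ v) (x : X f) (e : X (𝟙 u)),
    (⟨𝟙 u ≫ f, chi f (𝟙 u) ((X f).tmul (X (𝟙 u)) x e)⟩ : Σ g : u ⟶ v, X g)
      = ⟨f, (X f).ract x (unit u e)⟩
  chi_assoc : ∀ {t u v w : Λ} (α : v ⟶ w) (β : u ⟶ v) (γ : t ⟶ u)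
    (x : X α) (y : X β) (z : X γ),
    (⟨γ ≫ (β ≫ α), chi (β ≫ α) γ ((X (β ≫ α)).tmul (X γ) (chi α β ((X α).tmul (X β) x y)) z)⟩ :
        Σ g : t ⟶ w, X g)
      = ⟨(γ ≫ β) ≫ α, chi α (γ ≫ β) ((X α).tmul (X (γ ≫ β)) x (chi β γ ((X β).tmul (X γ) y z)))⟩

attribute [instance] LambdaSystem.cstar

namespace LambdaSystem

variable {k : ℕ} {Λ : Type u} [CategoryTheory.Category.{v} Λ] {D : KGraph k Λ}

/-- Regular `Λ`-systems. -/
structure IsRegular (S : LambdaSystem.{u, v, w, a} D) : Prop where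
  rowFiniteNoSources : D.IsRowFiniteNoSources
  nondegenerate : ∀ {u v : Λ} (f : u ⟶ v), (S.X f).IsNondegenerate
  full : ∀ {u v : Λ} (f : u ⟶ v), (S.X f).IsFull
  injective : ∀ {u v : Λ} (f : u ⟶ v), Function.Injective (S.X f).lact
  compact : ∀ {u v : Λ} (f : u ⟶ v) (b : S.A v), (S.X f).lact b ∈ (S.X f).compactOperators

/-- The `C0Sum S.A`-correspondence `Yₙ`, the `ℓ²`-direct sum of the `X f` over the paths `f` of degree
`n`. -/
noncomputable def fibre (S : LambdaSystem.{u, v, w, a} D) (n : Fin k → ℕ) :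
    CStarCorr.{max u a, max u a, max u v w} (C0Sum S.A) (C0Sum S.A) :=
  CStarCorr.directSum fun p : D.Path n => (S.X p.hom).inflate

/-- The inclusion of `X f` in `Yₙ`, where `n` is the degree of `f`. -/
noncomputable def incl (S : LambdaSystem.{u, v, w, a} D) {n : Fin k → ℕ} {s r : Λ} (f : s ⟶ r)
    (hf : D.degree f = n) (x : S.X f) : S.fibre n :=
  CStarCorr.directSumIncl (fun p : D.Path n => (S.X p.hom).inflate) ⟨s, r, f, hf⟩ x

end LambdaSystem

/-- The structure of a product system over `P` (written additively) on a family `Y` of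
`A`-`A` C⋆-correspondences: a multiplication which makes the disjoint union of the `Y p` a
semigroup, an identification `unit` of `Y 0` with the identity correspondence, isomorphisms
`Y p ⊗_A Y q ≅ Y (p + q)` for `p, q ≠ 0` induced by the multiplication, and multiplication by
elements of `Y 0 = A` is the given left and right action. -/
structure ProductSystem {P : Type v} [AddMonoid P] {A : Type u} [NonUnitalCStarAlgebra A]
    (Y : P → CStarCorr.{u, u, w} A A) where
  mul : ∀ {p q : P}, Y p → Y q → Y (p + q)
  mul_assoc : ∀ {p q r : P} (x : Y p) (y : Y q) (z : Y r),
    (⟨p + q + r, mul (mul x y) z⟩ : Σ p, Y p) = ⟨p + (q + r), mul x (mul y z)⟩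
  unit : CStarCorr.Hom (Y 0) (CStarCorr.ident A)
  unit_isIso : unit.IsIso
  exists_iso : ∀ p q : P, p ≠ 0 → q ≠ 0 →
    ∃ Θ : CStarCorr.Hom ((Y p).tensor (Y q)) (Y (p + q)), Θ.IsIso ∧
      ∀ (x : Y p) (y : Y q), Θ ((Y p).tmul (Y q) x y) = mul x y
  unit_mul : ∀ {p : P} (e : Y 0) (y : Y p),
    (⟨0 + p, mul e y⟩ : Σ p, Y p) = ⟨p, (Y p).lact (unit e) y⟩
  mul_unit : ∀ {p : P} (y : Y p) (e : Y 0),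
    (⟨p + 0, mul y e⟩ : Σ p, Y p) = ⟨p, (Y p).ract y (unit e)⟩

/-!
A map between total families of two correspondences that preserves inner products and commutes
with the left actions extends uniquely to a map of correspondences. The elementary tensors
`ι_α(x) ⊗ ι_β(y)` over composable pairs form a total family of `Yₘ ⊗ Yₙ`, since for `s(α) ≠ r(β)`
the inner square `⟨ι_β(y), ⟨ι_α(x), ι_α(x)⟩ ι_β(y)⟩` vanishes: `⟨ι_α(x), ι_α(x)⟩` is supported at
`s(α)` and acts on `ι_β(y)` through the coordinate `r(β)`. By unique factorisation `αβ = α'β'`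
forces `α = α'` and `β = β'` once the degrees agree, so `ι_α(x) ⊗ ι_β(y) ↦ ι_{αβ}(χ(x ⊗ y))`
preserves inner products and extends to `Yₘ ⊗ Yₙ → Yₘ₊ₙ`. The product system laws and uniqueness
are then checked on the summands. For the compactness of the left action, an element of `A`
supported at one vertex `v` acts as the sum of the finitely many operators `φ_λ(a)` with
`r(λ) = v`, extended by zero.
-/

universe x w₁

section TotalSet

variable {R M N : Type*} [Semiring R] [AddCommMonoid M] [Module R M] [TopologicalSpace M]
  [AddCommMonoid N] [Module R N] [TopologicalSpace N]

/-- A total set: one whose linear span is dense. -/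
def IsTotalSet (R : Type*) {M : Type*} [Semiring R] [AddCommMonoid M] [Module R M]
    [TopologicalSpace M] (s : Set M) : Prop :=
  Dense (Submodule.span R s : Set M)

theorem IsTotalSet.mem_of_isClosed {s : Set M} (hs : IsTotalSet R s) {P : Submodule R M}
    (hP : IsClosed (P : Set M)) (h : s ⊆ P) (x : M) : x ∈ P :=
  closure_minimal (Submodule.span_le.2 h) hP (hs x)

theorem map_mem_of_mem_topologicalClosure_span [ContinuousAdd M] [ContinuousConstSMul R M]
    (T : M →L[R] N) {s : Set M} {P : Submodule R N} (hP : IsClosed (P : Set N))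
    (h : ∀ x ∈ s, T x ∈ P) {x : M} (hx : x ∈ (Submodule.span R s).topologicalClosure) :
    T x ∈ P :=
  Submodule.topologicalClosure_minimal (t := P.comap T.toLinearMap) _ (Submodule.span_le.2 h)
    (hP.preimage T.continuous) hx

variable [ContinuousAdd M] [ContinuousConstSMul R M]

theorem IsTotalSet.of_subset_topologicalClosure_span {s t : Set M} (hs : IsTotalSet R s)
    (h : s ⊆ (Submodule.span R t).topologicalClosure) : IsTotalSet R t :=
  fun x => hs.mem_of_isClosed (Submodule.isClosed_topologicalClosure _) h x

theorem IsTotalSet.of_mapsTo_of_denseRange [ContinuousAdd N] [ContinuousConstSMul R N]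
    {s : Set M} (hs : IsTotalSet R s) (T : M →L[R] N) (hT : DenseRange T) {t : Set N}
    (h : Set.MapsTo T s t) : IsTotalSet R t := by
  refine (hT.mono ?_).of_closure
  rintro _ ⟨x, rfl⟩
  exact map_mem_of_mem_topologicalClosure_span T (Submodule.isClosed_topologicalClosure _)
    (fun y hy => Submodule.le_topologicalClosure _ (Submodule.subset_span (h hy))) (hs x)

end TotalSet

namespace CStarCorr

variable {A : Type u} {B : Type v} [NonUnitalCStarAlgebra A] [NonUnitalCStarAlgebra B]

section Continuity

variable (X : CStarCorr.{u, v, w} A B)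

theorem norm_inner_le (x y : X) : ‖X.inner x y‖ ≤ ‖x‖ * ‖y‖ := by
  refine le_of_sq_le_sq ?_ (by positivity)
  rw [mul_pow, X.norm_sq, X.norm_sq]
  exact X.toPreCStarCorr.norm_inner_sq_le x y

theorem norm_ract_le (x : X) (b : B) : ‖X.ract x b‖ ≤ ‖x‖ * ‖b‖ := by
  refine le_of_sq_le_sq ?_ (by positivity)
  rw [mul_pow, X.norm_sq, X.norm_sq, X.inner_ract, X.inner_ract_left]
  calc ‖star b * X.inner x x * b‖ ≤ ‖star b‖ * ‖X.inner x x‖ * ‖b‖ := norm_mul₃_le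
    _ = ‖X.inner x x‖ * ‖b‖ ^ 2 := by rw [norm_star]; ring

theorem norm_lact_le (a : A) (x : X) : ‖X.lact a x‖ ≤ ‖a‖ * ‖x‖ := by
  refine le_of_sq_le_sq ?_ (by positivity)
  rw [mul_pow, X.norm_sq, X.norm_sq]
  exact X.toPreCStarCorr.norm_inner_lact_le a x

/-- The inner product as a continuous sesquilinear map. -/
noncomputable def innerL : X →L⋆[ℂ] X →L[ℂ] B :=
  LinearMap.mkContinuous₂ X.inner 1 fun x y => by
    rw [one_mul]; exact X.norm_inner_le x y

/-- The right action as a continuous bilinear map. -/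
noncomputable def ractL : X →L[ℂ] B →L[ℂ] X :=
  LinearMap.mkContinuous₂ X.ract 1 fun x b => by
    rw [one_mul]; exact X.norm_ract_le x b

/-- The left action as a continuous bilinear map. -/
noncomputable def lactL : A →L[ℂ] X →L[ℂ] X :=
  LinearMap.mkContinuous₂ X.toPreCStarCorr.lact 1 fun a x => by
    rw [one_mul]; exact X.norm_lact_le a x

theorem isNondegenerate_iff_isTotalSet :
    X.IsNondegenerate ↔ IsTotalSet ℂ {z : X | ∃ (a : A) (x : X), X.lact a x = z} :=
  Submodule.dense_iff_topologicalClosure_eq_top.symm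

end Continuity

section Hom

variable {X : CStarCorr.{u, v, w} A B} {Z : CStarCorr.{u, v, w'} A B}

theorem Hom.norm_map (F : Hom X Z) (x : X) : ‖F x‖ = ‖x‖ := by
  rw [← sq_eq_sq₀ (norm_nonneg _) (norm_nonneg _), X.norm_sq, Z.norm_sq]
  exact congrArg _ (F.map_inner x x)

/-- A map of correspondences as a linear isometry. -/
def Hom.toLinearIsometry (F : Hom X Z) : X.carrier →ₗᵢ[ℂ] Z.carrier where
  toLinearMap := F.toLinearMap
  norm_map' := F.norm_map

theorem Hom.ext_of_isTotalSet {s : Set X} (hs : IsTotalSet ℂ s) {F G : Hom X Z}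
    (h : ∀ x ∈ s, F x = G x) : F = G := by
  have hFG : F.toLinearIsometry.toContinuousLinearMap = G.toLinearIsometry.toContinuousLinearMap :=
    ContinuousLinearMap.ext_on hs h
  have : F.toLinearMap = G.toLinearMap := LinearMap.ext fun x => DFunLike.congr_fun hFG x
  cases F; cases G
  congr

theorem Hom.isIso_of_isTotalSet (F : Hom X Z) {s : Set Z} (hs : IsTotalSet ℂ s)
    (h : ∀ z ∈ s, ∃ x, F x = z) : F.IsIso :=
  ⟨F.toLinearIsometry.injective, hs.mem_of_isClosed (P := F.toLinearMap.range)
    F.toLinearIsometry.isometry.isClosedEmbedding.isClosed_range h⟩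

/-- A map of correspondences from a linear map preserving inner products and left actions;
the right action is then preserved as well. -/
def Hom.ofMapInner (F : X.carrier →ₗ[ℂ] Z.carrier)
    (map_inner : ∀ x y, Z.inner (F x) (F y) = X.inner x y)
    (map_lact : ∀ a x, F (X.lact a x) = Z.lact a (F x)) : Hom X Z where
  toLinearMap := F
  map_inner := map_inner
  map_lact := map_lact
  map_ract x b := by
    change F (X.ract x b) = Z.ract (F x) b
    rw [← sub_eq_zero, ← norm_eq_zero, ← pow_eq_zero_iff two_ne_zero, Z.norm_sq]
    simp only [map_sub, LinearMap.sub_apply, Z.inner_ract, Z.inner_ract_left, map_inner,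
      X.inner_ract, X.inner_ract_left, mul_assoc, sub_self, norm_zero]

theorem map_inner_of_isTotalSet {s : Set X} (hs : IsTotalSet ℂ s)
    (F : X.carrier →L[ℂ] Z.carrier)
    (h : ∀ x ∈ s, ∀ y ∈ s, Z.inner (F x) (F y) = X.inner x y) (x y : X) :
    Z.inner (F x) (F y) = X.inner x y := by
  have h_left (x : X) (hx : x ∈ s) : (Z.innerL (F x)).comp F = X.innerL x :=
    ContinuousLinearMap.ext_on hs (h x hx)
  have h_right : (Z.innerL.flip (F y)).comp F = X.innerL.flip y :=
    ContinuousLinearMap.ext_on hs fun x hx => DFunLike.congr_fun (h_left x hx) y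
  exact DFunLike.congr_fun h_right x

section OfTotal

variable {I : Type*} (e : I → X.carrier) (f : I → Z.carrier)

theorem norm_linearCombination_eq_of_inner_eq
    (h_inner : ∀ i j, Z.inner (f i) (f j) = X.inner (e i) (e j)) (c : I →₀ ℂ) :
    ‖Finsupp.linearCombination ℂ f c‖ = ‖Finsupp.linearCombination ℂ e c‖ := by
  rw [← sq_eq_sq₀ (norm_nonneg _) (norm_nonneg _), X.norm_sq, Z.norm_sq]
  simp only [Finsupp.linearCombination_apply, Finsupp.sum, map_sum, LinearMap.sum_apply,
    map_smulₛₗ, LinearMap.smul_apply, h_inner]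

/-- The continuous linear extension of `e i ↦ f i`, a junk value unless the `e i` are total and the
norms of the linear combinations of the `f i` are bounded by those of the `e i`. -/
noncomputable def extendTotal : X.carrier →L[ℂ] Z.carrier :=
  (Finsupp.linearCombination ℂ f).extendOfNorm (Finsupp.linearCombination ℂ e)

variable {e f}

theorem extendTotal_apply (he : IsTotalSet ℂ (Set.range e))
    (h_inner : ∀ i j, Z.inner (f i) (f j) = X.inner (e i) (e j)) (i : I) :
    extendTotal e f (e i) = f i := by
  have h_dense : DenseRange (Finsupp.linearCombination ℂ e) := by
    change Dense (Set.range _)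
    rw [← LinearMap.coe_range, Finsupp.range_linearCombination]
    exact he
  simpa [extendTotal] using LinearMap.extendOfNorm_eq (f := Finsupp.linearCombination ℂ f) h_dense
    ⟨1, fun c => by rw [one_mul, norm_linearCombination_eq_of_inner_eq e f h_inner]⟩
    (Finsupp.single i 1)

/-- The map of correspondences sending each member `e i` of a total family to `f i`. -/
noncomputable def Hom.ofTotal (he : IsTotalSet ℂ (Set.range e))
    (h_inner : ∀ i j, Z.inner (f i) (f j) = X.inner (e i) (e j))
    (h_lact : ∀ a i, ∃ j, e j = X.lact a (e i) ∧ f j = Z.lact a (f i)) : Hom X Z :=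
  Hom.ofMapInner (extendTotal e f).toLinearMap
    (map_inner_of_isTotalSet he _ <| by
      rintro _ ⟨i, rfl⟩ _ ⟨j, rfl⟩
      rw [extendTotal_apply he h_inner, extendTotal_apply he h_inner, h_inner])
    fun a => by
      have h : (extendTotal e f).comp (X.lact a) = (Z.lact a).comp (extendTotal e f) := by
        refine ContinuousLinearMap.ext_on he ?_
        rintro _ ⟨i, rfl⟩
        obtain ⟨j, hej, hfj⟩ := h_lact a i
        simp only [ContinuousLinearMap.comp_apply, ← hej, extendTotal_apply he h_inner, hfj]
      exact DFunLike.congr_fun h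

theorem Hom.ofTotal_apply (he : IsTotalSet ℂ (Set.range e))
    (h_inner : ∀ i j, Z.inner (f i) (f j) = X.inner (e i) (e j))
    (h_lact : ∀ a i, ∃ j, e j = X.lact a (e i) ∧ f j = Z.lact a (f i)) (i : I) :
    Hom.ofTotal he h_inner h_lact (e i) = f i :=
  extendTotal_apply he h_inner i

end OfTotal

end Hom

section Tensor

variable {C : Type x} [NonUnitalCStarAlgebra C]
variable (X : CStarCorr.{u, v, w} A B) (Y : CStarCorr.{v, x, w'} B C)

theorem inner_tmul (x x' : X) (y y' : Y) :
    (X.tensor Y).inner (X.tmul Y x y) (X.tmul Y x' y') = Y.inner y (Y.lact (X.inner x x') y') :=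
  (preTensor X Y).complInner_coe _ _

theorem lact_tmul (a : A) (x : X) (y : Y) :
    (X.tensor Y).lact a (X.tmul Y x y) = X.tmul Y (X.lact a x) y :=
  (preTensor X Y).complLact_coe _ _

/-- The elementary tensors as a continuous bilinear map. -/
noncomputable def tmulL : X →L[ℂ] Y →L[ℂ] (X.tensor Y).carrier :=
  LinearMap.mkContinuous₂ ((TensorProduct.mk ℂ X.carrier Y.carrier).compr₂
    (preTensor X Y).toCompl.toLinearMap) 1 fun x y => by
    refine le_of_sq_le_sq ?_ (by positivity)
    change ‖X.tmul Y x y‖ ^ 2 ≤ _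
    rw [(X.tensor Y).norm_sq, inner_tmul, one_mul]
    calc ‖Y.inner y (Y.lact (X.inner x x) y)‖ ≤ ‖y‖ * (‖X.inner x x‖ * ‖y‖) :=
          (Y.norm_inner_le _ _).trans (by gcongr; exact Y.norm_lact_le _ _)
      _ = (‖x‖ * ‖y‖) ^ 2 := by rw [← X.norm_sq]; ring

theorem isTotalSet_tmul : IsTotalSet ℂ {z : X.tensor Y | ∃ x y, X.tmul Y x y = z} := by
  have h_span : IsTotalSet ℂ
      {t : (preTensor X Y).carrier | ∃ (x : X) (y : Y), x ⊗ₜ[ℂ] y = t} := fun t =>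
    subset_closure
      (Submodule.eq_top_iff'.1 (TensorProduct.span_tmul_eq_top ℂ X.carrier Y.carrier) t)
  refine h_span.of_mapsTo_of_denseRange (preTensor X Y).toCompl
    (preTensor X Y).denseRange_toCompl ?_
  rintro _ ⟨x, y, rfl⟩
  exact ⟨x, y, rfl⟩

variable {X Y}

theorem isTotalSet_image2_tmul {s : Set X} {t : Set Y} (hs : IsTotalSet ℂ s)
    (ht : IsTotalSet ℂ t) : IsTotalSet ℂ (Set.image2 (X.tmul Y) s t) := by
  refine (isTotalSet_tmul X Y).of_subset_topologicalClosure_span ?_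
  rintro _ ⟨x, y, rfl⟩
  refine map_mem_of_mem_topologicalClosure_span (tmulL X Y x)
    (Submodule.isClosed_topologicalClosure _) (fun y hy => ?_) (ht y)
  refine map_mem_of_mem_topologicalClosure_span ((tmulL X Y).flip y)
    (Submodule.isClosed_topologicalClosure _) (fun x hx => ?_) (hs x)
  exact Submodule.le_topologicalClosure _ (Submodule.subset_span (Set.mem_image2_of_mem hx hy))

/-- The continuous bilinear map `(x, y) ↦ F (x ⊗ y)`. -/
noncomputable def Hom.toBilin {Z : CStarCorr.{u, x, w₁} A C} (F : Hom (X.tensor Y) Z) :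
    X →L[ℂ] Y →L[ℂ] Z.carrier :=
  (ContinuousLinearMap.compL ℂ Y.carrier (X.tensor Y).carrier Z.carrier
    F.toLinearIsometry.toContinuousLinearMap).comp (tmulL X Y)

end Tensor

section DirectSum

variable {ι : Type w'} (X : ι → CStarCorr.{u, v, w} A B)

theorem inner_directSumIncl_self (i : ι) (x y : X i) :
    (directSum X).inner (directSumIncl X i x) (directSumIncl X i y) = (X i).inner x y := by
  classical
  refine ((preDirectSum X).complInner_coe _ _).trans
    ((finsum_eq_single _ i fun j hj => ?_).trans ?_)
  · simp [DFinsupp.single_eq_of_ne hj]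
  · simp

theorem inner_directSumIncl_of_ne {i j : ι} (h : i ≠ j) (x : X i) (y : X j) :
    (directSum X).inner (directSumIncl X i x) (directSumIncl X j y) = 0 := by
  classical
  refine ((preDirectSum X).complInner_coe _ _).trans (finsum_eq_zero_of_forall_eq_zero fun l => ?_)
  obtain rfl | hl := eq_or_ne l i
  · simp [DFinsupp.single_eq_of_ne h]
  · simp [DFinsupp.single_eq_of_ne hl]

theorem lact_directSumIncl (i : ι) (a : A) (x : X i) :
    (directSum X).lact a (directSumIncl X i x) = directSumIncl X i ((X i).lact a x) := by
  classical
  exact ((preDirectSum X).complLact_coe _ _).trans <| congrArg (preDirectSum X).toCompl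
    (DFinsupp.mapRange_single (f := fun i z => (X i).lact a z) (hf := by simp))

theorem ract_directSumIncl (i : ι) (x : X i) (b : B) :
    (directSum X).ract (directSumIncl X i x) b = directSumIncl X i ((X i).ract x b) := by
  classical
  exact ((preDirectSum X).complRact_coe _ _).trans <| congrArg (preDirectSum X).toCompl
    (DFinsupp.mapRange_single (f := fun i z => (X i).ract z b) (hf := by simp))

open scoped Classical in
/-- The inclusion of a summand as a linear isometry. -/
noncomputable def directSumInclL (i : ι) : (X i).carrier →ₗᵢ[ℂ] (directSum X).carrier where
  toLinearMap := (preDirectSum X).toCompl.toLinearMap ∘ₗ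
    DFinsupp.lsingle (M := fun i => (X i).carrier) i
  norm_map' x := by
    rw [← sq_eq_sq₀ (norm_nonneg _) (norm_nonneg _), HilbertModule.norm_sq,
      HilbertModule.norm_sq]
    exact congrArg _ (inner_directSumIncl_self X i x x)

theorem directSumIncl_zero (i : ι) : directSumIncl X i 0 = 0 :=
  map_zero (directSumInclL X i)

theorem isTotalSet_directSumIncl :
    IsTotalSet ℂ {z : directSum X | ∃ i x, directSumIncl X i x = z} := by
  classical
  have h_span : IsTotalSet ℂ {t : (preDirectSum X).carrier |
      ∃ i x, (DFinsupp.single i x : Π₀ i, (X i).carrier) = t} := by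
    refine fun t => subset_closure ?_
    induction t using DFinsupp.induction with
    | h0 => exact Submodule.zero_mem _
    | ha i x f _ _ ih => exact Submodule.add_mem _ (Submodule.subset_span ⟨i, x, rfl⟩) ih
  refine h_span.of_mapsTo_of_denseRange (preDirectSum X).toCompl
    (preDirectSum X).denseRange_toCompl ?_
  rintro _ ⟨i, x, rfl⟩
  exact ⟨i, x, rfl⟩

theorem directSum_continuousLinearMap_ext {F : Type*} [NormedAddCommGroup F] [NormedSpace ℂ F]
    {S T : (directSum X).carrier →L[ℂ] F}
    (h : ∀ i x, S (directSumIncl X i x) = T (directSumIncl X i x)) : S = T :=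
  ContinuousLinearMap.ext_on (isTotalSet_directSumIncl X) (by rintro _ ⟨i, x, rfl⟩; exact h i x)

theorem directSum_isNondegenerate (h : ∀ i, (X i).IsNondegenerate) :
    (directSum X).IsNondegenerate := by
  refine (isNondegenerate_iff_isTotalSet _).2
    ((isTotalSet_directSumIncl X).of_subset_topologicalClosure_span ?_)
  rintro _ ⟨i, x, rfl⟩
  refine map_mem_of_mem_topologicalClosure_span (directSumInclL X i).toContinuousLinearMap
    (Submodule.isClosed_topologicalClosure _) ?_
    ((isNondegenerate_iff_isTotalSet _).1 (h i) x)
  rintro _ ⟨a, x, rfl⟩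
  exact Submodule.le_topologicalClosure _
    (Submodule.subset_span ⟨a, directSumIncl X i x, lact_directSumIncl X i a x⟩)

theorem lact_eq_zero_of_directSum_lact_eq_zero {a : A} (h : (directSum X).lact a = 0) (i : ι) :
    (X i).lact a = 0 := by
  ext x
  refine (directSumInclL X i).injective ((lact_directSumIncl X i a x).symm.trans ?_)
  exact (DFunLike.congr_fun h _).trans (directSumIncl_zero X i).symm

end DirectSum

section CompactOperators

variable {ι : Type w'} (X : ι → CStarCorr.{u, v, w} A B)

theorem norm_apply_le_norm_preDirectSum (x : Π₀ i, (X i).carrier) (i : ι) :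
    ‖x i‖ ≤ ‖(show (preDirectSum X).carrier from x)‖ := by
  let _ := CStarAlgebra.spectralOrder B
  have := CStarAlgebra.spectralOrderedRing B
  refine le_of_sq_le_sq ?_ (by positivity)
  rw [HilbertModule.norm_sq, PreCStarCorr.norm_sq]
  refine CStarAlgebra.norm_le_norm_of_nonneg_of_le
    ((isCStarPositive_iff _).1 ((X i).inner_self_pos _)) ?_
  change _ ≤ ∑ᶠ i, (X i).inner (x i) (x i)
  exact single_le_finsum i (finite_support_inner X x x)
    fun j => (isCStarPositive_iff _).1 ((X j).inner_self_pos _)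

/-- The projection of a direct sum onto a summand. -/
noncomputable def directSumProj (i : ι) : (directSum X).carrier →L[ℂ] (X i).carrier :=
  ((DFinsupp.lapply (M := fun i => (X i).carrier) (R := ℂ) i : _ →ₗ[ℂ] _).mkContinuous
    (E := (preDirectSum X).carrier) 1 fun x => by
      rw [one_mul]; exact norm_apply_le_norm_preDirectSum X x i).extend (preDirectSum X).toCompl

theorem directSumProj_directSumIncl_self (i : ι) (x : X i) :
    directSumProj X i (directSumIncl X i x) = x := by
  classical
  exact (ContinuousLinearMap.extend_eq _ (preDirectSum X).denseRange_toCompl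
    (preDirectSum X).isUniformInducing_toCompl _).trans
    (DFinsupp.single_eq_same (β := fun i => (X i).carrier))

theorem directSumProj_directSumIncl_of_ne {i j : ι} (h : i ≠ j) (x : X j) :
    directSumProj X i (directSumIncl X j x) = 0 := by
  classical
  exact (ContinuousLinearMap.extend_eq _ (preDirectSum X).denseRange_toCompl
    (preDirectSum X).isUniformInducing_toCompl _).trans
    (DFinsupp.single_eq_of_ne (β := fun i => (X i).carrier) h)

/-- The extension by zero of an operator on the summand `X i`. -/
noncomputable def extendByZero (i : ι) : ((X i).carrier →L[ℂ] (X i).carrier) →L[ℂ]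
    ((directSum X).carrier →L[ℂ] (directSum X).carrier) :=
  (ContinuousLinearMap.compL ℂ (directSum X).carrier (X i).carrier (directSum X).carrier
    (directSumInclL X i).toContinuousLinearMap).comp
      ((ContinuousLinearMap.compL ℂ (directSum X).carrier (X i).carrier (X i).carrier).flip
        (directSumProj X i))

theorem extendByZero_directSumIncl_self (i : ι) (T : (X i).carrier →L[ℂ] (X i).carrier)
    (x : X i) : extendByZero X i T (directSumIncl X i x) = directSumIncl X i (T x) :=
  congrArg (fun y => directSumIncl X i (T y)) (directSumProj_directSumIncl_self X i x)

theorem extendByZero_directSumIncl_of_ne {i j : ι} (h : i ≠ j)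
    (T : (X i).carrier →L[ℂ] (X i).carrier) (x : X j) :
    extendByZero X i T (directSumIncl X j x) = 0 := by
  refine (congrArg (fun y => directSumIncl X i (T y))
    (directSumProj_directSumIncl_of_ne X h x)).trans ?_
  rw [map_zero, directSumIncl_zero]

theorem extendByZero_rankOne (i : ι) (x y : X i) :
    extendByZero X i ((X i).rankOne x y)
      = (directSum X).rankOne (directSumIncl X i x) (directSumIncl X i y) := by
  refine directSum_continuousLinearMap_ext X fun j z => ?_
  change _ = (directSum X).ract (directSumIncl X i x)
    ((directSum X).inner (directSumIncl X i y) (directSumIncl X j z))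
  obtain rfl | h := eq_or_ne i j
  · rw [extendByZero_directSumIncl_self, inner_directSumIncl_self, ract_directSumIncl]
    rfl
  · rw [extendByZero_directSumIncl_of_ne X h, inner_directSumIncl_of_ne X h, map_zero]

theorem extendByZero_mem_compactOperators (i : ι) {T : (X i).carrier →L[ℂ] (X i).carrier}
    (hT : T ∈ (X i).compactOperators) : extendByZero X i T ∈ (directSum X).compactOperators := by
  refine map_mem_of_mem_topologicalClosure_span (extendByZero X i)
    (Submodule.isClosed_topologicalClosure _) ?_ hT
  rintro _ ⟨x, y, rfl⟩
  exact Submodule.le_topologicalClosure _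
    (Submodule.subset_span ⟨_, _, extendByZero_rankOne X i x y⟩)

theorem directSum_lact_eq_sum_extendByZero {a : A} (h : {i | (X i).lact a ≠ 0}.Finite) :
    (directSum X).lact a = ∑ i ∈ h.toFinset, extendByZero X i ((X i).lact a) := by
  refine directSum_continuousLinearMap_ext X fun j x => ?_
  rw [sum_apply, Finset.sum_eq_single j, extendByZero_directSumIncl_self,
    lact_directSumIncl]
  · exact fun i _ hij => extendByZero_directSumIncl_of_ne X hij _ x
  · intro hj
    have hj : (X j).lact a = 0 := by simpa using hj
    rw [hj, map_zero, zero_apply]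

theorem directSum_lact_mem_compactOperators {a : A} (h : {i | (X i).lact a ≠ 0}.Finite)
    (hc : ∀ i, (X i).lact a ∈ (X i).compactOperators) :
    (directSum X).lact a ∈ (directSum X).compactOperators := by
  rw [directSum_lact_eq_sum_extendByZero X h]
  exact Submodule.sum_mem _ fun i _ => extendByZero_mem_compactOperators X i (hc i)

end CompactOperators

end CStarCorr

namespace C0Sum

open scoped ENNReal

variable {V : Type w} {A : V → Type u} [∀ v, NonUnitalCStarAlgebra (A v)]

theorem single_apply_self (v : V) (a : A v) : (single A v a).1 v = a := by
  classical
  exact lp.single_apply_self ∞ v a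

theorem single_apply_of_ne {v v' : V} (h : v' ≠ v) (a : A v) : (single A v a).1 v' = 0 := by
  classical
  exact lp.single_apply_ne ∞ v a h

theorem mul_single (v : V) (a : A v) (b : C0Sum A) :
    b * single A v a = single A v (b.1 v * a) := by
  rw [← star_inj, star_mul, star_single, star_single, ← single_mul, star_mul]
  rfl

theorem star_single_mul_single (v : V) (a b : A v) :
    star (single A v a) * single A v b = single A v (star a * b) := by
  rw [star_single, ← single_mul, single_apply_self]

theorem star_single_mul_single_of_ne {v v' : V} (h : v' ≠ v) (a : A v) (b : A v') :
    star (single A v a) * single A v' b = 0 := by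
  rw [star_single, ← single_mul, single_apply_of_ne h.symm, mul_zero, map_zero]

theorem sum_single_apply_of_mem {s : Finset V} {v : V} (hv : v ∈ s) (b : ∀ v, A v) :
    (∑ v' ∈ s, single A v' (b v')).1 v = b v := by
  rw [AddSubmonoidClass.coe_finsetSum, lp.coeFn_sum, Finset.sum_apply,
    Finset.sum_eq_single_of_mem v hv fun v' _ h => single_apply_of_ne h.symm _, single_apply_self]

theorem sum_single_apply_of_notMem {s : Finset V} {v : V} (hv : v ∉ s) (b : ∀ v, A v) :
    (∑ v' ∈ s, single A v' (b v')).1 v = 0 := by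
  rw [AddSubmonoidClass.coe_finsetSum, lp.coeFn_sum, Finset.sum_apply]
  exact Finset.sum_eq_zero fun v' hv' => single_apply_of_ne (ne_of_mem_of_not_mem hv' hv).symm _

theorem isTotalSet_single : IsTotalSet ℂ {b : C0Sum A | ∃ v a, single A v a = b} := by
  refine fun b => Metric.mem_closure_iff.2 fun ε hε => ?_
  have hb : Filter.Tendsto (fun v => ‖b.1 v‖) Filter.cofinite (nhds 0) := b.2
  have hfin : {v | ¬ ‖b.1 v‖ < ε / 2}.Finite :=
    Filter.eventually_cofinite.1 (hb.eventually (gt_mem_nhds (half_pos hε)))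
  refine ⟨∑ v ∈ hfin.toFinset, single A v (b.1 v),
    Submodule.sum_mem _ fun v _ => Submodule.subset_span ⟨v, _, rfl⟩, ?_⟩
  rw [dist_eq_norm]
  refine lt_of_le_of_lt (lp.norm_le_of_forall_le (half_pos hε).le fun v => ?_) (half_lt_self hε)
  change ‖b.1 v - (∑ v ∈ hfin.toFinset, single A v (b.1 v)).1 v‖ ≤ ε / 2
  by_cases hv : v ∈ hfin.toFinset
  · rw [sum_single_apply_of_mem hv, sub_self, norm_zero]
    exact (half_pos hε).le
  · rw [sum_single_apply_of_notMem hv, sub_zero]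
    exact (not_not.1 (mt hfin.mem_toFinset.2 hv)).le

end C0Sum

namespace CStarCorr

variable {V : Type w} {A : V → Type u} [∀ v, NonUnitalCStarAlgebra (A v)] {r s : V}
  {X : CStarCorr.{u, u, w'} (A r) (A s)}

theorem inflate_isNondegenerate (h : X.IsNondegenerate) : X.inflate.IsNondegenerate := by
  rw [isNondegenerate_iff_isTotalSet] at h ⊢
  refine h.of_subset_topologicalClosure_span ?_
  rintro _ ⟨a, x, rfl⟩
  refine Submodule.le_topologicalClosure _ (Submodule.subset_span ⟨C0Sum.single A r a, x, ?_⟩)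
  exact congrArg (fun a => X.lact a x) (C0Sum.single_apply_self r a)

theorem inflate_compactOperators : X.inflate.compactOperators = X.compactOperators := by
  have h_rankOne (x y : X) : X.inflate.rankOne x y = X.rankOne x y :=
    ContinuousLinearMap.ext fun z =>
      congrArg (X.ract x) (C0Sum.single_apply_self s (X.inner y z))
  exact congrArg (fun f : X → X → X.carrier →L[ℂ] X.carrier =>
    (Submodule.span ℂ {T | ∃ x y, T = f x y}).topologicalClosure) (funext₂ h_rankOne)

end CStarCorr

namespace KGraph

variable {k : ℕ} {Λ : Type u} [CategoryTheory.Category.{v} Λ] (D : KGraph k Λ)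

theorem exists_eq_id_of_degree_eq_zero (p : D.Path 0) : ∃ b, p = ⟨b, b, 𝟙 b, D.degree_id b⟩ := by
  obtain ⟨s, r, f, hf⟩ := p
  have h := (D.factorisation f 0 0 (by simpa using hf)).unique
    (y₁ := ⟨s, f, 𝟙 s⟩) (y₂ := ⟨r, 𝟙 r, f⟩)
    ⟨hf, D.degree_id s, CategoryTheory.Category.id_comp f⟩
    ⟨D.degree_id r, hf, CategoryTheory.Category.comp_id f⟩
  obtain rfl : s = r := congrArg Sigma.fst h
  obtain rfl : f = 𝟙 s := congrArg Prod.fst (eq_of_heq (Sigma.mk.inj h).2)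
  exact ⟨s, rfl⟩

theorem eq_and_eq_of_comp_eq {m n : Fin k → ℕ} {t v r t' v' r' : Λ} {α : v ⟶ r} {β : t ⟶ v}
    {α' : v' ⟶ r'} {β' : t' ⟶ v'} (hα : D.degree α = m) (hβ : D.degree β = n)
    (hα' : D.degree α' = m) (hβ' : D.degree β' = n) {h h'}
    (e : (⟨t, r, β ≫ α, h⟩ : D.Path (m + n)) = ⟨t', r', β' ≫ α', h'⟩) :
    (⟨v, r, α, hα⟩ : D.Path m) = ⟨v', r', α', hα'⟩ ∧
      (⟨t, v, β, hβ⟩ : D.Path n) = ⟨t', v', β', hβ'⟩ := by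
  obtain rfl : t = t' := congrArg Path.src e
  obtain rfl : r = r' := congrArg Path.rng e
  have e' : β ≫ α = β' ≫ α' := by simpa using e
  have h_unique := (D.factorisation (β ≫ α) m n h).unique
    (y₁ := ⟨v, α, β⟩) (y₂ := ⟨v', α', β'⟩) ⟨hα, hβ, rfl⟩ ⟨hα', hβ', e'.symm⟩
  obtain rfl : v = v' := congrArg Sigma.fst h_unique
  obtain ⟨rfl, rfl⟩ := Prod.mk.inj (eq_of_heq (Sigma.mk.inj h_unique).2)
  exact ⟨rfl, rfl⟩

end KGraph

theorem ProductSystem.ext_of_unit_of_ne_zero {P : Type v} [AddMonoid P] {A : Type u}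
    [NonUnitalCStarAlgebra A] {Y : P → CStarCorr.{u, u, w} A A} {Z Z' : ProductSystem Y}
    (h_unit : Z.unit = Z'.unit)
    (h_mul : ∀ {p q : P}, p ≠ 0 → q ≠ 0 → ∀ (x : Y p) (y : Y q), Z.mul x y = Z'.mul x y) :
    Z = Z' := by
  have h {p q : P} (x : Y p) (y : Y q) : Z.mul x y = Z'.mul x y := by
    by_cases hp : p = 0
    · subst hp
      have h_left := Z.unit_mul x y
      rw [h_unit, ← Z'.unit_mul x y] at h_left
      exact eq_of_heq (Sigma.mk.inj h_left).2
    by_cases hq : q = 0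
    · subst hq
      have h_right := Z.mul_unit x y
      rw [h_unit, ← Z'.mul_unit x y] at h_right
      exact eq_of_heq (Sigma.mk.inj h_right).2
    exact h_mul hp hq x y
  cases Z
  cases Z'
  congr 1
  exact funext fun p => funext fun q => funext₂ h

namespace LambdaSystem

variable {k : ℕ} {Λ : Type u} [CategoryTheory.Category.{v} Λ] {D : KGraph k Λ}
  (S : LambdaSystem.{u, v, w, a} D)

section Fibre

variable {n : Fin k → ℕ} {s r : Λ} (f : s ⟶ r) (hf : D.degree f = n)

theorem inner_incl_self (x y : S.X f) :
    (S.fibre n).inner (S.incl f hf x) (S.incl f hf y) = C0Sum.single S.A s ((S.X f).inner x y) :=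
  CStarCorr.inner_directSumIncl_self (fun p : D.Path n => (S.X p.hom).inflate) ⟨s, r, f, hf⟩ x y

theorem inner_incl_of_ne {s' r' : Λ} (g : s' ⟶ r') (hg : D.degree g = n)
    (h : (⟨s, r, f, hf⟩ : D.Path n) ≠ ⟨s', r', g, hg⟩) (x : S.X f) (y : S.X g) :
    (S.fibre n).inner (S.incl f hf x) (S.incl g hg y) = 0 :=
  CStarCorr.inner_directSumIncl_of_ne (fun p : D.Path n => (S.X p.hom).inflate) h x y

theorem lact_incl (b : C0Sum S.A) (x : S.X f) :
    (S.fibre n).lact b (S.incl f hf x) = S.incl f hf ((S.X f).lact (b.1 r) x) :=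
  CStarCorr.lact_directSumIncl (fun p : D.Path n => (S.X p.hom).inflate) ⟨s, r, f, hf⟩ b x

theorem ract_incl (x : S.X f) (b : C0Sum S.A) :
    (S.fibre n).ract (S.incl f hf x) b = S.incl f hf ((S.X f).ract x (b.1 s)) :=
  CStarCorr.ract_directSumIncl (fun p : D.Path n => (S.X p.hom).inflate) ⟨s, r, f, hf⟩ x b

/-- The inclusion of `X f` in `Yₙ` as a linear isometry. -/
noncomputable def inclL : (S.X f).carrier →ₗᵢ[ℂ] (S.fibre n).carrier :=
  CStarCorr.directSumInclL (fun p : D.Path n => (S.X p.hom).inflate) ⟨s, r, f, hf⟩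

theorem incl_zero : S.incl f hf 0 = 0 :=
  map_zero (S.inclL f hf)

variable {f} in
theorem incl_eq_incl {g : s ⟶ r} {x : S.X f} {y : S.X g}
    (h : (⟨f, x⟩ : Σ g : s ⟶ r, S.X g) = ⟨g, y⟩) (hg : D.degree g = n) :
    S.incl f hf x = S.incl g hg y := by
  cases h
  rfl

variable (n) in
theorem isTotalSet_incl : IsTotalSet ℂ {z : S.fibre n | ∃ (s r : Λ) (f : s ⟶ r)
    (hf : D.degree f = n) (x : S.X f), S.incl f hf x = z} := by
  refine (CStarCorr.isTotalSet_directSumIncl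
    fun p : D.Path n => (S.X p.hom).inflate).of_subset_topologicalClosure_span ?_
  rintro _ ⟨⟨s, r, f, hf⟩, x, rfl⟩
  exact Submodule.le_topologicalClosure _ (Submodule.subset_span ⟨s, r, f, hf, x, rfl⟩)

theorem isTotalSet_incl_id : IsTotalSet ℂ (Set.range fun p : Σ b : Λ, S.X (𝟙 b) =>
    S.incl (𝟙 p.1) (D.degree_id p.1) p.2) := by
  refine (S.isTotalSet_incl 0).of_subset_topologicalClosure_span ?_
  rintro _ ⟨s, r, f, hf, x, rfl⟩
  obtain ⟨b, hb⟩ := D.exists_eq_id_of_degree_eq_zero ⟨s, r, f, hf⟩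
  cases hb
  exact Submodule.le_topologicalClosure _ (Submodule.subset_span ⟨⟨_, x⟩, rfl⟩)

variable {F : Type*} [NormedAddCommGroup F] [NormedSpace ℂ F]

theorem eq_of_incl {g h : (S.fibre n).carrier →L[ℂ] F}
    (H : ∀ {s r : Λ} (f : s ⟶ r) (hf : D.degree f = n) (x : S.X f),
      g (S.incl f hf x) = h (S.incl f hf x)) (y : S.fibre n) : g y = h y :=
  DFunLike.congr_fun (ContinuousLinearMap.ext_on (S.isTotalSet_incl n) <| by
    rintro _ ⟨s, r, f, hf, x, rfl⟩
    exact H f hf x) y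

theorem eq_of_incl_id {g h : (S.fibre 0).carrier →L[ℂ] F}
    (H : ∀ (b : Λ) (e : S.X (𝟙 b)),
      g (S.incl (𝟙 b) (D.degree_id b) e) = h (S.incl (𝟙 b) (D.degree_id b) e))
    (y : S.fibre 0) : g y = h y :=
  DFunLike.congr_fun (ContinuousLinearMap.ext_on S.isTotalSet_incl_id <| by
    rintro _ ⟨⟨b, e⟩, rfl⟩
    exact H b e) y

end Fibre

section FibreCast

variable {m n : Fin k → ℕ} (h : m = n)

/-- The identification of `Yₘ` with `Yₙ` when `m = n`.  It turns equations in the disjoint union of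
the fibres into equations between continuous linear maps. -/
noncomputable def fibreCast : (S.fibre m).carrier →L[ℂ] (S.fibre n).carrier :=
  h ▸ ContinuousLinearMap.id ℂ (S.fibre m).carrier

theorem sigma_eq_of_fibreCast_eq {x : S.fibre m} {y : S.fibre n} (e : S.fibreCast h x = y) :
    (⟨m, x⟩ : Σ p, S.fibre p) = ⟨n, y⟩ := by
  subst h e
  rfl

theorem fibreCast_incl {s r : Λ} (f : s ⟶ r) (hf : D.degree f = m) (x : S.X f) :
    S.fibreCast h (S.incl f hf x) = S.incl f (hf.trans h) x := by
  subst h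
  rfl

end FibreCast

section Multiplication

/-- A pair of elements `x ∈ X α`, `y ∈ X β` over a composable pair of paths `α`, `β` of degrees
`m` and `n`. -/
structure ComposablePair (m n : Fin k → ℕ) where
  {src mid rng : Λ}
  left : mid ⟶ rng
  right : src ⟶ mid
  degree_left : D.degree left = m
  degree_right : D.degree right = n
  fst : S.X left
  snd : S.X right

namespace ComposablePair

variable {S} {m n : Fin k → ℕ} (p q : S.ComposablePair m n)

/-- The elementary tensor `x ⊗ y` in `Yₘ ⊗ Yₙ`. -/
noncomputable def tmul : ((S.fibre m).tensor (S.fibre n)).carrier :=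
  (S.fibre m).tmul (S.fibre n) (S.incl p.left p.degree_left p.fst)
    (S.incl p.right p.degree_right p.snd)

/-- The product `χ(x ⊗ y)` in `Yₘ₊ₙ`. -/
noncomputable def prod : S.fibre (m + n) :=
  S.incl (p.right ≫ p.left) (by rw [D.degree_comp, p.degree_left, p.degree_right])
    (S.chi p.left p.right ((S.X p.left).tmul (S.X p.right) p.fst p.snd))

/-- The pair `(b x, y)`. -/
noncomputable def lact (b : C0Sum S.A) : S.ComposablePair m n :=
  { p with fst := (S.X p.left).lact (b.1 p.rng) p.fst }

theorem tmul_lact (b : C0Sum S.A) :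
    (p.lact b).tmul = ((S.fibre m).tensor (S.fibre n)).lact b p.tmul :=
  Eq.trans (congrArg (fun x => (S.fibre m).tmul (S.fibre n) x (S.incl p.right p.degree_right p.snd))
    (S.lact_incl p.left p.degree_left b p.fst).symm) (CStarCorr.lact_tmul _ _ _ _ _).symm

theorem prod_lact (b : C0Sum S.A) : (p.lact b).prod = (S.fibre (m + n)).lact b p.prod := by
  refine Eq.trans (congrArg (S.incl (p.right ≫ p.left) _) ?_) (S.lact_incl _ _ b _).symm
  exact (congrArg (S.chi p.left p.right) (CStarCorr.lact_tmul _ _ _ _ _).symm).trans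
    ((S.chi p.left p.right).map_lact _ _)

theorem inner_prod_eq_inner_tmul :
    (S.fibre (m + n)).inner p.prod q.prod
      = ((S.fibre m).tensor (S.fibre n)).inner p.tmul q.tmul := by
  obtain ⟨α, β, hα, hβ, x, y⟩ := p
  obtain ⟨α', β', hα', hβ', x', y'⟩ := q
  refine Eq.trans ?_ (CStarCorr.inner_tmul _ _ _ _ _ _).symm
  dsimp only [prod]
  by_cases hp : (⟨_, _, α, hα⟩ : D.Path m) = ⟨_, _, α', hα'⟩
  · by_cases hq : (⟨_, _, β, hβ⟩ : D.Path n) = ⟨_, _, β', hβ'⟩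
    · cases hp
      cases hq
      simp only [S.lact_incl, S.inner_incl_self, C0Sum.single_apply_self]
      exact congrArg _ (((S.chi α β).map_inner _ _).trans (CStarCorr.inner_tmul _ _ _ _ _ _))
    · rw [S.lact_incl, S.inner_incl_of_ne _ _ _ _ hq]
      exact S.inner_incl_of_ne _ _ _ _ (fun e => hq (D.eq_and_eq_of_comp_eq hα hβ hα' hβ' e).2) _ _
  · simp only [S.inner_incl_of_ne _ _ _ _ hp, map_zero, zero_apply]
    exact S.inner_incl_of_ne _ _ _ _ (fun e => hp (D.eq_and_eq_of_comp_eq hα hβ hα' hβ' e).1) _ _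

end ComposablePair

variable {m n : Fin k → ℕ}

theorem tmul_incl_of_ne {t v v' r : Λ} (h : v ≠ v') (α : v ⟶ r) (β : t ⟶ v')
    (hα : D.degree α = m) (hβ : D.degree β = n) (x : S.X α) (y : S.X β) :
    (S.fibre m).tmul (S.fibre n) (S.incl α hα x) (S.incl β hβ y) = 0 := by
  rw [← norm_eq_zero, ← pow_eq_zero_iff two_ne_zero, HilbertModule.norm_sq, CStarCorr.inner_tmul,
    S.inner_incl_self, S.lact_incl, C0Sum.single_apply_of_ne h.symm, map_zero, zero_apply,
    S.incl_zero, map_zero, norm_zero]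

variable (m n) in
theorem isTotalSet_tmul_composablePair :
    IsTotalSet ℂ (Set.range (ComposablePair.tmul : S.ComposablePair m n → _)) := by
  refine (CStarCorr.isTotalSet_image2_tmul (S.isTotalSet_incl m)
    (S.isTotalSet_incl n)).of_subset_topologicalClosure_span ?_
  rintro _ ⟨_, ⟨v, r, α, hα, x, rfl⟩, _, ⟨t, v', β, hβ, y, rfl⟩, rfl⟩
  by_cases h : v = v'
  · subst h
    exact Submodule.le_topologicalClosure _ (Submodule.subset_span ⟨⟨α, β, hα, hβ, x, y⟩, rfl⟩)
  · rw [S.tmul_incl_of_ne h]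
    exact Submodule.zero_mem _

theorem isTotalSet_prod_composablePair (hm : m ≠ 0) :
    IsTotalSet ℂ (Set.range (ComposablePair.prod : S.ComposablePair m n → _)) := by
  refine (S.isTotalSet_incl (m + n)).of_subset_topologicalClosure_span ?_
  rintro _ ⟨t, r, f, hf, z, rfl⟩
  obtain ⟨⟨v, α, β⟩, ⟨hα, hβ, rfl⟩, -⟩ := D.factorisation f m n hf
  dsimp only at hα hβ z ⊢
  obtain ⟨z, rfl⟩ := (S.chi_isIso α β (hα ▸ hm)).2 z
  refine map_mem_of_mem_topologicalClosure_span ((S.inclL (β ≫ α) hf).comp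
    (S.chi α β).toLinearIsometry).toContinuousLinearMap
    (Submodule.isClosed_topologicalClosure _) ?_ (CStarCorr.isTotalSet_tmul (S.X α) (S.X β) z)
  rintro _ ⟨x, y, rfl⟩
  exact Submodule.le_topologicalClosure _ (Submodule.subset_span ⟨⟨α, β, hα, hβ, x, y⟩, rfl⟩)

variable (m n) in
/-- The map of correspondences `Yₘ ⊗ Yₙ → Yₘ₊ₙ` given on composable pairs by `χ`. -/
noncomputable def mulHom : CStarCorr.Hom ((S.fibre m).tensor (S.fibre n)) (S.fibre (m + n)) :=
  CStarCorr.Hom.ofTotal (S.isTotalSet_tmul_composablePair m n)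
    ComposablePair.inner_prod_eq_inner_tmul
    fun b p => ⟨p.lact b, p.tmul_lact b, p.prod_lact b⟩

theorem mulHom_tmul (p : S.ComposablePair m n) : S.mulHom m n p.tmul = p.prod :=
  CStarCorr.Hom.ofTotal_apply _ _ _ p

theorem mulHom_isIso (hm : m ≠ 0) : (S.mulHom m n).IsIso := by
  refine CStarCorr.Hom.isIso_of_isTotalSet _ (S.isTotalSet_prod_composablePair hm) ?_
  rintro _ ⟨p, rfl⟩
  exact ⟨p.tmul, S.mulHom_tmul p⟩

variable (m n) in
/-- The multiplication `Yₘ × Yₙ → Yₘ₊ₙ`. -/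
noncomputable def fibreMul :
    (S.fibre m).carrier →L[ℂ] (S.fibre n).carrier →L[ℂ] (S.fibre (m + n)).carrier :=
  (S.mulHom m n).toBilin

theorem fibreMul_incl {t v r : Λ} (α : v ⟶ r) (β : t ⟶ v)
    (hα : D.degree α = m) (hβ : D.degree β = n) (x : S.X α) (y : S.X β) :
    S.fibreMul m n (S.incl α hα x) (S.incl β hβ y)
      = S.incl (β ≫ α) (by rw [D.degree_comp, hα, hβ]) (S.chi α β ((S.X α).tmul (S.X β) x y)) :=
  S.mulHom_tmul ⟨α, β, hα, hβ, x, y⟩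

theorem fibreMul_incl_of_ne {t v v' r : Λ} (h : v ≠ v') (α : v ⟶ r) (β : t ⟶ v')
    (hα : D.degree α = m) (hβ : D.degree β = n) (x : S.X α) (y : S.X β) :
    S.fibreMul m n (S.incl α hα x) (S.incl β hβ y) = 0 :=
  (congrArg (S.mulHom m n) (S.tmul_incl_of_ne h α β hα hβ x y)).trans
    (map_zero (S.mulHom m n).toLinearMap)

end Multiplication

section Associativity

variable {l m n : Fin k → ℕ}

theorem fibreMul_assoc_incl {s t t' v v' r : Λ} (α : v ⟶ r) (β : t ⟶ v') (γ : s ⟶ t')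
    (hα : D.degree α = l) (hβ : D.degree β = m) (hγ : D.degree γ = n)
    (x : S.X α) (y : S.X β) (z : S.X γ) :
    S.fibreCast (add_assoc l m n)
        (S.fibreMul (l + m) n (S.fibreMul l m (S.incl α hα x) (S.incl β hβ y)) (S.incl γ hγ z))
      = S.fibreMul l (m + n) (S.incl α hα x)
          (S.fibreMul m n (S.incl β hβ y) (S.incl γ hγ z)) := by
  by_cases hv : v = v' <;> by_cases ht : t = t'
  · subst hv ht
    simp only [S.fibreMul_incl, S.fibreCast_incl]
    exact S.incl_eq_incl _ (S.chi_assoc α β γ x y z) _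
  · subst hv
    simp only [S.fibreMul_incl α β, S.fibreMul_incl_of_ne ht, map_zero]
  · subst ht
    simp only [S.fibreMul_incl β γ, S.fibreMul_incl_of_ne hv, map_zero, zero_apply]
  · simp only [S.fibreMul_incl_of_ne hv, S.fibreMul_incl_of_ne ht, map_zero, zero_apply]

theorem fibreMul_assoc (x : S.fibre l) (y : S.fibre m) (z : S.fibre n) :
    S.fibreCast (add_assoc l m n) (S.fibreMul (l + m) n (S.fibreMul l m x y) z)
      = S.fibreMul l (m + n) x (S.fibreMul m n y z) := by
  refine S.eq_of_incl
    (g := (S.fibreCast (add_assoc l m n)).comp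
      (((S.fibreMul (l + m) n).flip z).comp ((S.fibreMul l m).flip y)))
    (h := (S.fibreMul l (m + n)).flip (S.fibreMul m n y z)) (fun α hα x => ?_) x
  refine S.eq_of_incl
    (g := (S.fibreCast (add_assoc l m n)).comp
      (((S.fibreMul (l + m) n).flip z).comp (S.fibreMul l m (S.incl α hα x))))
    (h := (S.fibreMul l (m + n) (S.incl α hα x)).comp ((S.fibreMul m n).flip z))
    (fun β hβ y => ?_) y
  exact S.eq_of_incl
    (g := (S.fibreCast (add_assoc l m n)).comp
      (S.fibreMul (l + m) n (S.fibreMul l m (S.incl α hα x) (S.incl β hβ y))))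
    (h := (S.fibreMul l (m + n) (S.incl α hα x)).comp (S.fibreMul m n (S.incl β hβ y)))
    (fun γ hγ z => S.fibreMul_assoc_incl α β γ hα hβ hγ x y z) z

end Associativity

section Unit

theorem star_single_unit_mul_single_unit (p q : Σ b : Λ, S.X (𝟙 b)) :
    star (C0Sum.single S.A p.1 (S.unit p.1 p.2)) * C0Sum.single S.A q.1 (S.unit q.1 q.2)
      = (S.fibre 0).inner (S.incl (𝟙 p.1) (D.degree_id p.1) p.2)
          (S.incl (𝟙 q.1) (D.degree_id q.1) q.2) := by
  obtain ⟨b, e⟩ := p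
  obtain ⟨c, e'⟩ := q
  by_cases h : b = c
  · subst h
    exact (C0Sum.star_single_mul_single b (S.unit b e) (S.unit b e')).trans <|
      (congrArg (C0Sum.single S.A b) ((S.unit b).map_inner e e')).trans
        (S.inner_incl_self (𝟙 b) (D.degree_id b) e e').symm
  · exact (C0Sum.star_single_mul_single_of_ne (Ne.symm h) _ _).trans
      (S.inner_incl_of_ne _ _ _ _ (fun h' => h (congrArg KGraph.Path.src h')) e e').symm

theorem single_unit_lact (c : C0Sum S.A) (p : Σ b : Λ, S.X (𝟙 b)) :
    C0Sum.single S.A p.1 (S.unit p.1 ((S.X (𝟙 p.1)).lact (c.1 p.1) p.2))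
      = c * C0Sum.single S.A p.1 (S.unit p.1 p.2) :=
  (congrArg (C0Sum.single S.A p.1) ((S.unit p.1).map_lact (c.1 p.1) p.2)).trans
    (C0Sum.mul_single p.1 (S.unit p.1 p.2) c).symm

theorem exists_incl_eq_lact_and_single_unit_eq_mul (c : C0Sum S.A) (p : Σ b : Λ, S.X (𝟙 b)) :
    ∃ q : Σ b : Λ, S.X (𝟙 b),
      S.incl (𝟙 q.1) (D.degree_id q.1) q.2
          = (S.fibre 0).lact c (S.incl (𝟙 p.1) (D.degree_id p.1) p.2) ∧
        C0Sum.single S.A q.1 (S.unit q.1 q.2) = c * C0Sum.single S.A p.1 (S.unit p.1 p.2) :=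
  ⟨⟨p.1, (S.X (𝟙 p.1)).lact (c.1 p.1) p.2⟩,
    (S.lact_incl (𝟙 p.1) (D.degree_id p.1) c p.2).symm, S.single_unit_lact c p⟩

/-- The map of correspondences `Y₀ → A` given on the summands by the maps `X (𝟙 b) → A b`. -/
noncomputable def unitHom : CStarCorr.Hom (S.fibre 0) (CStarCorr.ident (C0Sum S.A)) :=
  CStarCorr.Hom.ofTotal S.isTotalSet_incl_id (Z := CStarCorr.ident (C0Sum S.A))
    (f := fun p : Σ b : Λ, S.X (𝟙 b) => C0Sum.single S.A p.1 (S.unit p.1 p.2))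
    S.star_single_unit_mul_single_unit S.exists_incl_eq_lact_and_single_unit_eq_mul

theorem unitHom_incl (b : Λ) (e : S.X (𝟙 b)) :
    S.unitHom (S.incl (𝟙 b) (D.degree_id b) e) = C0Sum.single S.A b (S.unit b e) :=
  CStarCorr.Hom.ofTotal_apply S.isTotalSet_incl_id (Z := CStarCorr.ident (C0Sum S.A))
    (f := fun p : Σ b : Λ, S.X (𝟙 b) => C0Sum.single S.A p.1 (S.unit p.1 p.2))
    S.star_single_unit_mul_single_unit S.exists_incl_eq_lact_and_single_unit_eq_mul ⟨b, e⟩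

theorem unitHom_isIso : S.unitHom.IsIso := by
  refine S.unitHom.isIso_of_isTotalSet (C0Sum.isTotalSet_single (A := S.A)) ?_
  rintro _ ⟨b, c, rfl⟩
  obtain ⟨e, he⟩ := (S.unit_isIso b).2 c
  exact ⟨_, (S.unitHom_incl b e).trans (congrArg (C0Sum.single S.A b) he)⟩

variable {n : Fin k → ℕ} {b s r : Λ} (f : s ⟶ r) (hf : D.degree f = n)

theorem fibreMul_incl_id_left (e : S.X (𝟙 b)) (y : S.X f) :
    S.fibreCast (zero_add n) (S.fibreMul 0 n (S.incl (𝟙 b) (D.degree_id b) e) (S.incl f hf y))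
      = (S.fibre n).lact (C0Sum.single S.A b (S.unit b e)) (S.incl f hf y) := by
  rw [S.lact_incl]
  by_cases hb : b = r
  · subst hb
    rw [S.fibreMul_incl, S.fibreCast_incl]
    refine S.incl_eq_incl _ ((S.chi_range f e y).trans ?_) hf
    exact congrArg (fun c => (⟨f, (S.X f).lact c y⟩ : Σ g : s ⟶ b, S.X g))
      (C0Sum.single_apply_self b (S.unit b e)).symm
  · have h_lact : (S.X f).lact ((C0Sum.single S.A b (S.unit b e)).1 r) y = 0 :=
      (congrArg (fun c => (S.X f).lact c y)
        (C0Sum.single_apply_of_ne (Ne.symm hb) (S.unit b e))).trans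
        (DFunLike.congr_fun (map_zero (S.X f).lact) y)
    rw [S.fibreMul_incl_of_ne hb, map_zero, h_lact, S.incl_zero]

theorem fibreMul_incl_id_right (y : S.X f) (e : S.X (𝟙 b)) :
    S.fibreCast (add_zero n) (S.fibreMul n 0 (S.incl f hf y) (S.incl (𝟙 b) (D.degree_id b) e))
      = (S.fibre n).ract (S.incl f hf y) (C0Sum.single S.A b (S.unit b e)) := by
  rw [S.ract_incl]
  by_cases hb : s = b
  · subst hb
    rw [S.fibreMul_incl, S.fibreCast_incl]
    refine S.incl_eq_incl _ ((S.chi_source f y e).trans ?_) hf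
    exact congrArg (fun c => (⟨f, (S.X f).ract y c⟩ : Σ g : s ⟶ r, S.X g))
      (C0Sum.single_apply_self s (S.unit s e)).symm
  · have h_ract : (S.X f).ract y ((C0Sum.single S.A b (S.unit b e)).1 s) = 0 :=
      (congrArg ((S.X f).ract y) (C0Sum.single_apply_of_ne hb (S.unit b e))).trans (map_zero _)
    rw [S.fibreMul_incl_of_ne hb, map_zero, h_ract, S.incl_zero]

theorem fibreMul_unit_left (e : S.fibre 0) (y : S.fibre n) :
    S.fibreCast (zero_add n) (S.fibreMul 0 n e y) = (S.fibre n).lact (S.unitHom e) y := by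
  refine S.eq_of_incl_id
    (g := (S.fibreCast (zero_add n)).comp ((S.fibreMul 0 n).flip y))
    (h := ((S.fibre n).lactL.flip y).comp S.unitHom.toLinearIsometry.toContinuousLinearMap)
    (fun b e => ?_) e
  refine S.eq_of_incl
    (g := (S.fibreCast (zero_add n)).comp (S.fibreMul 0 n (S.incl (𝟙 b) (D.degree_id b) e)))
    (h := (S.fibre n).lact (S.unitHom (S.incl (𝟙 b) (D.degree_id b) e)))
    (fun f hf y => ?_) y
  exact (S.fibreMul_incl_id_left f hf e y).trans
    (congrArg (fun c => (S.fibre n).lact c (S.incl f hf y)) (S.unitHom_incl b e).symm)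

theorem fibreMul_unit_right (y : S.fibre n) (e : S.fibre 0) :
    S.fibreCast (add_zero n) (S.fibreMul n 0 y e) = (S.fibre n).ract y (S.unitHom e) := by
  refine S.eq_of_incl_id
    (g := (S.fibreCast (add_zero n)).comp (S.fibreMul n 0 y))
    (h := ((S.fibre n).ractL y).comp S.unitHom.toLinearIsometry.toContinuousLinearMap)
    (fun b e => ?_) e
  refine S.eq_of_incl
    (g := (S.fibreCast (add_zero n)).comp
      ((S.fibreMul n 0).flip (S.incl (𝟙 b) (D.degree_id b) e)))
    (h := (S.fibre n).ractL.flip (S.unitHom (S.incl (𝟙 b) (D.degree_id b) e)))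
    (fun f hf y => ?_) y
  exact (S.fibreMul_incl_id_right f hf y e).trans
    (congrArg ((S.fibre n).ract (S.incl f hf y)) (S.unitHom_incl b e).symm)

end Unit

/-- The product system of a `Λ`-system. -/
noncomputable def productSystem : ProductSystem S.fibre where
  mul x y := S.fibreMul _ _ x y
  mul_assoc x y z := S.sigma_eq_of_fibreCast_eq (add_assoc _ _ _) (S.fibreMul_assoc x y z)
  unit := S.unitHom
  unit_isIso := S.unitHom_isIso
  exists_iso m n hm _ := ⟨S.mulHom m n, S.mulHom_isIso hm, fun _ _ => rfl⟩
  unit_mul e y := S.sigma_eq_of_fibreCast_eq (zero_add _) (S.fibreMul_unit_left e y)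
  mul_unit y e := S.sigma_eq_of_fibreCast_eq (add_zero _) (S.fibreMul_unit_right y e)

section Uniqueness

/-- The compatibility of a product system structure on the fibres with the `Λ`-system: on the
summands the unit is that of the system and the product is `χ` for composable paths and zero
otherwise. -/
def IsCompatible (Y : ProductSystem S.fibre) : Prop :=
  (∀ (v : Λ) (e : S.X (𝟙 v)),
    Y.unit (S.incl (𝟙 v) (D.degree_id v) e) = C0Sum.single S.A v (S.unit v e)) ∧
  (∀ {u v w : Λ} {m n : Fin k → ℕ} (α : v ⟶ w) (β : u ⟶ v) (hα : D.degree α = m)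
    (hβ : D.degree β = n) (x : S.X α) (y : S.X β),
    Y.mul (S.incl α hα x) (S.incl β hβ y)
      = S.incl (β ≫ α) (by rw [D.degree_comp, hα, hβ]) (S.chi α β ((S.X α).tmul (S.X β) x y))) ∧
  (∀ {u v v' w : Λ} {m n : Fin k → ℕ} (α : v ⟶ w) (β : u ⟶ v') (hα : D.degree α = m)
    (hβ : D.degree β = n) (x : S.X α) (y : S.X β), v ≠ v' →
    Y.mul (S.incl α hα x) (S.incl β hβ y) = 0)

theorem productSystem_isCompatible : S.IsCompatible S.productSystem :=
  ⟨S.unitHom_incl, S.fibreMul_incl, fun α β hα hβ x y h => S.fibreMul_incl_of_ne h α β hα hβ x y⟩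

variable {S}

theorem IsCompatible.eq {Y Y' : ProductSystem S.fibre} (hY : S.IsCompatible Y)
    (hY' : S.IsCompatible Y') : Y = Y' := by
  obtain ⟨h_unit, h_comp, -⟩ := hY
  obtain ⟨h_unit', h_comp', -⟩ := hY'
  refine ProductSystem.ext_of_unit_of_ne_zero ?_ fun {m n} hm hn x y => ?_
  · refine CStarCorr.Hom.ext_of_isTotalSet S.isTotalSet_incl_id ?_
    rintro _ ⟨⟨b, e⟩, rfl⟩
    exact (h_unit b e).trans (h_unit' b e).symm
  · obtain ⟨Θ, -, hΘ⟩ := Y.exists_iso m n hm hn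
    obtain ⟨Θ', -, hΘ'⟩ := Y'.exists_iso m n hm hn
    have h_eq : Θ = Θ' := by
      refine CStarCorr.Hom.ext_of_isTotalSet (S.isTotalSet_tmul_composablePair m n) ?_
      rintro _ ⟨⟨α, β, hα, hβ, x, y⟩, rfl⟩
      exact (hΘ _ _).trans <| (h_comp α β hα hβ x y).trans <|
        (h_comp' α β hα hβ x y).symm.trans (hΘ' _ _).symm
    rw [← hΘ, ← hΘ', h_eq]

end Uniqueness

section LeftAction

variable {n : Fin k → ℕ}

theorem fibre_isNondegenerate (h : ∀ p : D.Path n, (S.X p.hom).IsNondegenerate) :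
    (S.fibre n).IsNondegenerate :=
  CStarCorr.directSum_isNondegenerate _ fun p => CStarCorr.inflate_isNondegenerate (h p)

theorem fibre_lact_injective (h_nonempty : ∀ v, {p : D.Path n | p.rng = v}.Nonempty)
    (h : ∀ p : D.Path n, Function.Injective (S.X p.hom).lact) :
    Function.Injective (S.fibre n).lact := by
  rw [injective_iff_map_eq_zero]
  intro b hb
  refine Subtype.ext (lp.ext (funext fun v => ?_))
  obtain ⟨p, rfl⟩ := h_nonempty v
  have h_lact : (S.X p.hom).lact (b.1 p.rng) = 0 :=
    CStarCorr.lact_eq_zero_of_directSum_lact_eq_zero _ hb p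
  exact (injective_iff_map_eq_zero _).1 (h p) _ h_lact

theorem fibre_lact_mem_compactOperators (h_finite : ∀ v, {p : D.Path n | p.rng = v}.Finite)
    (h : ∀ (p : D.Path n) (c : S.A p.rng), (S.X p.hom).lact c ∈ (S.X p.hom).compactOperators)
    (b : C0Sum S.A) : (S.fibre n).lact b ∈ (S.fibre n).compactOperators := by
  refine map_mem_of_mem_topologicalClosure_span (S.fibre n).lactL
    (Submodule.isClosed_topologicalClosure _) ?_ (C0Sum.isTotalSet_single (A := S.A) b)
  rintro _ ⟨v, c, rfl⟩
  refine CStarCorr.directSum_lact_mem_compactOperators _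
    ((h_finite v).subset fun p hp => ?_) fun p => ?_
  · by_contra hv
    refine hp ((congrArg (S.X p.hom).lact (C0Sum.single_apply_of_ne hv c)).trans (map_zero _))
  · rw [CStarCorr.inflate_compactOperators]
    exact h p _

end LeftAction

end LambdaSystem

theorem proposition3p1p7_general {k : ℕ} {Λ : Type u} [CategoryTheory.Category.{v} Λ]
    (D : KGraph k Λ) (S : LambdaSystem.{u, v, w, a} D) :
    (∃! Y : ProductSystem S.fibre, S.IsCompatible Y) ∧
    ∀ n : Fin k → ℕ,
      ((∀ p : D.Path n, (S.X p.hom).IsNondegenerate) → (S.fibre n).IsNondegenerate) ∧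
      ((∀ v, {p : D.Path n | p.rng = v}.Nonempty) →
        (∀ p : D.Path n, Function.Injective (S.X p.hom).lact) →
        Function.Injective (S.fibre n).lact) ∧
      ((∀ v, {p : D.Path n | p.rng = v}.Finite) →
        (∀ (p : D.Path n) (c : S.A p.rng), (S.X p.hom).lact c ∈ (S.X p.hom).compactOperators) →
        ∀ b, (S.fibre n).lact b ∈ (S.fibre n).compactOperators) :=
  ⟨⟨S.productSystem, S.productSystem_isCompatible, fun _ hY => hY.eq S.productSystem_isCompatible⟩,
    fun _ => ⟨S.fibre_isNondegenerate, S.fibre_lact_injective, S.fibre_lact_mem_compactOperators⟩⟩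

theorem proposition3p1p7 {k : ℕ} {Λ : Type u} [CategoryTheory.Category.{v} Λ] (D : KGraph k Λ)
    (S : LambdaSystem.{u, v, w, a} D) :
    (∃! Y : ProductSystem S.fibre,
      (∀ (v : Λ) (e : S.X (𝟙 v)),
        Y.unit (S.incl (𝟙 v) (D.degree_id v) e) = C0Sum.single S.A v (S.unit v e)) ∧
      (∀ {u v w : Λ} {m n : Fin k → ℕ} (α : v ⟶ w) (β : u ⟶ v) (hα : D.degree α = m)
        (hβ : D.degree β = n) (x : S.X α) (y : S.X β),
        Y.mul (S.incl α hα x) (S.incl β hβ y)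
          = S.incl (β ≫ α) (by rw [D.degree_comp, hα, hβ])
              (S.chi α β ((S.X α).tmul (S.X β) x y))) ∧
      (∀ {u v v' w : Λ} {m n : Fin k → ℕ} (α : v ⟶ w) (β : u ⟶ v') (hα : D.degree α = m)
        (hβ : D.degree β = n) (x : S.X α) (y : S.X β), v ≠ v' →
        Y.mul (S.incl α hα x) (S.incl β hβ y) = 0)) ∧
    (S.IsRegular →
      (∀ n, (S.fibre n).IsNondegenerate) ∧
      ∀ n, Function.Injective (S.fibre n).lact ∧
        ∀ b, (S.fibre n).lact b ∈ (S.fibre n).compactOperators) := by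
  have h := (proposition3p1p7_general D S).2
  exact ⟨(proposition3p1p7_general D S).1, fun hS =>
    ⟨fun n => (h n).1 fun p => hS.nondegenerate p.hom, fun n =>
      ⟨(h n).2.1 (fun v => (hS.rowFiniteNoSources v n).2) fun p => hS.injective p.hom,
        (h n).2.2 (fun v => (hS.rowFiniteNoSources v n).1) fun p => hS.compact p.hom⟩⟩⟩
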